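/- Let $(P,\{\cdot,\cdot\})$ be a (Hausdorff, finite-dimensional, smooth) Poisson manifold, $H\in C^\infty(P)$, and let $X_H$ be the Hamiltonian vector field, $X_H[F]=\{F,H\}$ for all $F\in C^\infty(P)$. Let $\mathcal E_z=\{X_G(z)\mid G\in C^\infty(P)\}\subset T_zP$ be the characteristic distribution; its maximal connected integral manifolds are the symplectic leaves, so that $T_z\mathcal L=\mathcal E_z$ for $z$ in a leaf $\mathcal L$. A point is regular if the leaves through all nearby points have the same dimension (that is, $\dim\mathcal E_w$ is constant for $w$ near the point), and a leaf is regular if all its points are regular. Let $z_e$ be an equilibrium of $X_H$ ($X_H(z_e)=0$) that lies on a regular symplectic leaf $\mathcal L$, and let $L:T_{z_e}P\to T_{z_e}P$, $L(v)=\frac{d}{dt}\big|_{t=0}T_{z_e}\Phi_t(v)$, be the linearization of $X_H$ at $z_e$, where $\Phi_t$ is the local flow of $X_H$. A Darboux–Weinstein chart around $z_e$ is a chart centred at $z_e$ with coordinates $(\mathbf x,\mathbf z)$, $\mathbf x=(q^1,\dots,q^n,p_1,\dots,p_n)$, $\mathbf z=(z^1,\dots,z^r)$, in which $\{q^i,q^j\}=\{p_i,p_j\}=\{q^i,z^k\}=\{p_i,z^k\}=0$,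 $\{q^i,p_j\}=\delta^i_j$, and $\{z^k,z^l\}=\mathcal R^{kl}(\mathbf z)$ depends only on $\mathbf z$ and vanishes at $\mathbf z=0$. With $J=\begin{pmatrix}0&I_n\\-I_n&0\end{pmatrix}$ put $$\mathcal S^i_j=\sum_{p=1}^{2n}J^{ip}\frac{\partial^2H}{\partial x^p\partial x^j}(0,0),\quad \mathcal Q^i_l=\sum_{p=1}^{2n}J^{ip}\frac{\partial^2H}{\partial x^p\partial z^l}(0,0),\quad \mathcal P^k_l=\sum_{p=1}^{r}\frac{\partial\mathcal R^{kp}}{\partial z^l}(0)\frac{\partial H}{\partial z^p}(0,0).$$ Then: 1. In every Darboux–Weinstein chart around $z_e$ the matrix of $L$ is $\begin{pmatrix}\mathcal S&\mathcal Q\\0&\mathcal P\end{pmatrix}$, and $\mathcal P=0$. 2. If $u\in T_{z_e}P$ satisfies $Lu=\lambda u$ for some real $\lambda\neq0$, then $u\in T_{z_e}\mathcal L$. Likewise, if $u\in\mathbb C\otimes T_{z_e}P$ satisfies $Lu=\lambda u$ for some complex $\lambda\ne0$, then $u\in\mathbb C\otimes T_{z_e}\mathcal L$. In particular the unstable directions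 of $L$ (the real vectors in the sum of the generalized eigenspaces of the complexification of $L$ for the eigenvalues with positive real part) are tangent to $\mathcal L$. 3. Consider a Darboux–Weinstein chart around $z_e$, let $\lambda_1,\dots,\lambda_{2n}\in\mathbb C$ be the eigenvalues of $\mathcal S$ counted with algebraic multiplicity, and let $v_1,\dots,v_r$ be a basis of $\mathbb C^r$ consisting of eigenvectors of $\mathcal P$ such that for every $j$ the equation $\mathcal S w=\mathcal Q v_j$ has a solution $w\in\mathbb C^{2n}$. Then the eigenvalues of $L$, counted with algebraic multiplicity, are $\lambda_1,\dots,\lambda_{2n}$ and $r$ times $0$; in particular, $0$ is the only eigenvalue of $L$ in addition to $\lambda_1,\dots,\lambda_{2n}$ (and it is an eigenvalue if $r>0$). -/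

import Mathlib

open scoped Manifold ContDiff Matrix TensorProduct

universe u v

namespace PoissonLin

/-! ### Auxiliary facts: point derivations are tangent vectors -/

section aux

open Set Filter Topology MeasureTheory

/-- Smoothness of `y ↦ ∫₀¹ K (y, t) dt`. -/
theorem parametricIntegral_contDiff_nat {E : Type} [NormedAddCommGroup E] [NormedSpace ℝ E]
    [FiniteDimensional ℝ E] (n : ℕ) :
    ∀ {G : Type} [NormedAddCommGroup G] [NormedSpace ℝ G] [CompleteSpace G] (K : E × ℝ → G),
      ContDiff ℝ ∞ K → ContDiff ℝ n (fun y => ∫ t in (0:ℝ)..1, K (y, t)) := by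
  induction n with
  | zero =>
    intro G _ _ _ K hK
    simp only [Nat.cast_zero, contDiff_zero]
    exact intervalIntegral.continuous_parametric_intervalIntegral_of_continuous' (by simpa [Function.uncurry_def] using hK.continuous) 0 1
  | succ n ih =>
    intro G _ _ _ K hK
    have hd : Differentiable ℝ K := hK.differentiable (by simp)
    let K' : E × ℝ → (E →L[ℝ] G) := fun p => (fderiv ℝ K p).comp (ContinuousLinearMap.inl ℝ E ℝ)
    have hK' : ContDiff ℝ ∞ K' := by
      have h1 : ContDiff ℝ ∞ (fderiv ℝ K) := hK.fderiv_right (by simp)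
      exact h1.clm_comp contDiff_const
    have hder : ∀ y t, HasFDerivAt (fun y => K (y, t)) (K' (y, t)) y := by
      intro y t
      exact (hd (y, t)).hasFDerivAt.comp y (hasFDerivAt_prodMk_left y t)
    rw [Nat.cast_succ, contDiff_succ_iff_hasFDerivAt]
    refine ⟨fun y => ∫ t in (0:ℝ)..1, K' (y, t), ih K' hK', fun y => ?_⟩
    obtain ⟨C, hC⟩ := ((isCompact_closedBall y 1).prod (isCompact_Icc (a := (0:ℝ)) (b := 1))).exists_bound_of_continuousOn hK'.continuous.continuousOn
    refine intervalIntegral.hasFDerivAt_integral_of_dominated_of_fderiv_le (F := fun y t => K (y, t)) (F' := fun y t => K' (y, t))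
      (bound := fun _ => C) (Metric.closedBall_mem_nhds y one_pos) ?_ ?_ ?_ ?_ ?_ ?_
    · exact Eventually.of_forall fun x => (hK.continuous.comp (by fun_prop)).aestronglyMeasurable
    · exact (hK.continuous.comp (by fun_prop)).intervalIntegrable _ _
    · exact (hK'.continuous.comp (by fun_prop)).aestronglyMeasurable
    · refine Eventually.of_forall fun t ht x hx => hC (x, t) ⟨hx, ?_⟩
      rw [uIoc_of_le zero_le_one] at ht
      exact ⟨ht.1.le, ht.2⟩
    · simp
    · exact Eventually.of_forall fun t ht x hx => hder x t

/-- Hadamard's lemma. -/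
theorem hadamard_lemma {m : ℕ} (f : EuclideanSpace ℝ (Fin m) → ℝ) (hf : ContDiff ℝ ∞ f)
    (y₀ : EuclideanSpace ℝ (Fin m)) :
    ∃ g : Fin m → EuclideanSpace ℝ (Fin m) → ℝ, (∀ a, ContDiff ℝ ∞ (g a)) ∧
      (∀ a, g a y₀ = fderiv ℝ f y₀ (EuclideanSpace.single a 1)) ∧
      ∀ y, f y = f y₀ + ∑ a, (y a - y₀ a) * g a y := by
  have hf' : ContDiff ℝ ∞ (fderiv ℝ f) := hf.fderiv_right (by simp)
  have hd : Differentiable ℝ f := hf.differentiable (by simp)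
  have hK : ∀ a : Fin m, ContDiff ℝ ∞ (fun p : EuclideanSpace ℝ (Fin m) × ℝ =>
      fderiv ℝ f (y₀ + p.2 • (p.1 - y₀)) (EuclideanSpace.single a 1)) := by
    intro a
    refine ContDiff.clm_apply (hf'.comp ?_) contDiff_const
    fun_prop
  refine ⟨fun a y => ∫ t in (0:ℝ)..1, fderiv ℝ f (y₀ + t • (y - y₀)) (EuclideanSpace.single a 1), ?_, ?_, ?_⟩
  · intro a
    rw [contDiff_infty]
    exact fun n => parametricIntegral_contDiff_nat n _ (hK a)
  · intro a
    simp
  · intro y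
    have h1 : ∀ t ∈ uIcc (0:ℝ) 1, HasDerivAt (fun t : ℝ => f (y₀ + t • (y - y₀)))
        (fderiv ℝ f (y₀ + t • (y - y₀)) (y - y₀)) t := by
      intro t _
      have h2 : HasDerivAt (fun t : ℝ => y₀ + t • (y - y₀)) (y - y₀) t := by
        simpa using ((hasDerivAt_id t).smul_const (y - y₀)).const_add y₀
      exact (hd _).hasFDerivAt.comp_hasDerivAt t h2
    have hc : ∀ v, Continuous fun t : ℝ => fderiv ℝ f (y₀ + t • (y - y₀)) v := fun v =>
      (hf'.continuous.comp (by fun_prop)).clm_apply continuous_const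
    have h3 := intervalIntegral.integral_eq_sub_of_hasDerivAt h1 ((hc _).intervalIntegrable _ _)
    have h4 : y - y₀ = ∑ a, (y a - y₀ a) • EuclideanSpace.single a (1:ℝ) := by
      ext i
      simp [Finset.sum_apply, Pi.single_apply]
    have h5 : (∫ t in (0:ℝ)..1, fderiv ℝ f (y₀ + t • (y - y₀)) (y - y₀)) =
        ∑ a, (y a - y₀ a) * ∫ t in (0:ℝ)..1, fderiv ℝ f (y₀ + t • (y - y₀)) (EuclideanSpace.single a 1) := by
      simp_rw [← intervalIntegral.integral_const_mul]
      rw [← intervalIntegral.integral_finsetSum]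
      · refine intervalIntegral.integral_congr fun t _ => ?_
        conv_lhs => rw [h4]
        simp only [map_sum, map_smul, smul_eq_mul]
        rw [← h4]
      · exact fun a _ => ((hc _).const_mul _ |>.intervalIntegrable _ _) 
    rw [← h5, h3]
    simp

section derivations

variable {m : ℕ} {P : Type u} [TopologicalSpace P] [T2Space P]
  [ChartedSpace (EuclideanSpace ℝ (Fin m)) P] [IsManifold (𝓡 m) ∞ P]

/-- A point derivation of `C^∞(P)` only depends on germs. -/
theorem derivation_congr (D : C^∞⟮𝓡 m, P; ℝ⟯ →ₗ[ℝ] ℝ) (z : P)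
    (hD : ∀ F G, D (F * G) = F z * D G + D F * G z) {F G : C^∞⟮𝓡 m, P; ℝ⟯}
    (h : (F : P → ℝ) =ᶠ[𝓝 z] G) : D F = D G := by
  have key : ∀ K : C^∞⟮𝓡 m, P; ℝ⟯, (K : P → ℝ) =ᶠ[𝓝 z] 0 → D K = 0 := by
    intro K hK
    obtain ⟨ψ, -, hψ⟩ := (SmoothBumpFunction.nhds_basis_support (I := 𝓡 m) hK).mem_iff.1 hK
    let Ψ : C^∞⟮𝓡 m, P; ℝ⟯ := ⟨ψ, ψ.contMDiff⟩
    have h0 : Ψ * K = 0 := by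
      ext w
      by_cases hw : w ∈ Function.support ψ
      · have : K w = 0 := hψ hw
        simp [this]
      · have : ψ w = 0 := by simpa using hw
        change ψ w * K w = 0
        simp [this]
    have h1 := hD Ψ K
    have h2 : Ψ z = 1 := ψ.eq_one
    have h3 : K z = 0 := hK.self_of_nhds
    rw [h0, h2, h3] at h1
    simpa using h1.symm
  have := key (F - G) (by
    filter_upwards [h] with w hw
    simp [hw])
  rw [map_sub] at this
  linarith

/-- A point derivation kills constants. -/
theorem derivation_const (D : C^∞⟮𝓡 m, P; ℝ⟯ →ₗ[ℝ] ℝ) (z : P)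
    (hD : ∀ F G, D (F * G) = F z * D G + D F * G z) (c : ℝ) :
    D (c • (1 : C^∞⟮𝓡 m, P; ℝ⟯)) = 0 := by
  have h := hD 1 1
  have h1 : (1 : C^∞⟮𝓡 m, P; ℝ⟯) z = 1 := rfl
  rw [mul_one, h1] at h
  rw [map_smul]
  have : D 1 = 0 := by linarith
  simp [this]

/-- Every function that is smooth near `z` has the germ of a global smooth function. -/
theorem exists_extension (z : P) (f : P → ℝ) {s : Set P} (hs : s ∈ 𝓝 z)
    (hf : ContMDiffOn (𝓡 m) 𝓘(ℝ, ℝ) ∞ f s) :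
    ∃ F : C^∞⟮𝓡 m, P; ℝ⟯, (F : P → ℝ) =ᶠ[𝓝 z] f := by
  obtain ⟨ψ, -, hψ⟩ := (SmoothBumpFunction.nhds_basis_tsupport (I := 𝓡 m) z).mem_iff.1
    (interior_mem_nhds.2 hs)
  have hsm : ContMDiff (𝓡 m) 𝓘(ℝ, ℝ) ∞ (fun w => ψ w * f w) := by
    refine contMDiff_of_tsupport fun w hw => ?_
    have hw' : w ∈ tsupport ψ := closure_mono (Function.support_mul_subset_left _ _) hw
    have : s ∈ 𝓝 w := mem_interior_iff_mem_nhds.1 (hψ hw')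
    exact ψ.contMDiffAt.mul (hf.contMDiffAt this)
  refine ⟨⟨_, hsm⟩, ?_⟩
  filter_upwards [ψ.eventuallyEq_one] with w hw
  change ψ w * f w = f w
  simp [hw]

/-- Every point derivation of `C^∞(P)` is the derivative along a tangent vector. -/
theorem exists_tangent_of_derivation (D : C^∞⟮𝓡 m, P; ℝ⟯ →ₗ[ℝ] ℝ) (z : P)
    (hD : ∀ F G, D (F * G) = F z * D G + D F * G z) :
    ∃ v : TangentSpace (𝓡 m) z, ∀ F : C^∞⟮𝓡 m, P; ℝ⟯,
      (mfderiv (𝓡 m) 𝓘(ℝ, ℝ) F z : TangentSpace (𝓡 m) z → ℝ) v = D F := by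
  set φ := chartAt (EuclideanSpace ℝ (Fin m)) z with hφ
  have hφs : ContMDiffOn (𝓡 m) (𝓡 m) ∞ φ φ.source := contMDiffOn_chart
  have hsrc : φ.source ∈ 𝓝 z := chart_source_mem_nhds _ z
  have hY : ∀ a : Fin m, ∃ Y : C^∞⟮𝓡 m, P; ℝ⟯, (Y : P → ℝ) =ᶠ[𝓝 z] fun w => φ w a - φ z a := by
    intro a
    refine exists_extension z _ hsrc ?_
    have : ContMDiff (𝓡 m) 𝓘(ℝ, ℝ) ∞ (fun y : EuclideanSpace ℝ (Fin m) => y a - φ z a) := by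
      apply ContDiff.contMDiff
      fun_prop
    exact this.comp_contMDiffOn hφs
  choose Y hY using hY
  refine ⟨(WithLp.toLp 2 fun a => D (Y a) : EuclideanSpace ℝ (Fin m)), fun F => ?_⟩
  have hsymm : ContMDiffOn (𝓡 m) (𝓡 m) ∞ φ.symm φ.target := contMDiffOn_chart_symm
  have htgt : φ.target ∈ 𝓝 (φ z) := chart_target_mem_nhds _ z
  obtain ⟨f', hf'⟩ := exists_extension (m := m) (P := EuclideanSpace ℝ (Fin m)) (φ z) (F ∘ φ.symm) htgt
    (F.contMDiff.comp_contMDiffOn hsymm)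
  have hfs : ContDiff ℝ ∞ (f' : EuclideanSpace ℝ (Fin m) → ℝ) := f'.contMDiff.contDiff
  obtain ⟨g, hg, hg0, hfg⟩ := hadamard_lemma f' hfs (φ z)
  have hG : ∀ a : Fin m, ∃ G : C^∞⟮𝓡 m, P; ℝ⟯, (G : P → ℝ) =ᶠ[𝓝 z] fun w => g a (φ w) := fun a =>
    exists_extension z _ hsrc ((hg a).contMDiff.comp_contMDiffOn hφs)
  choose G hG using hG
  have hcont : Tendsto φ (𝓝 z) (𝓝 (φ z)) := φ.continuousAt (mem_chart_source _ z)
  have hFeq : (F : P → ℝ) =ᶠ[𝓝 z] (F z • (1 : C^∞⟮𝓡 m, P; ℝ⟯) + ∑ a, Y a * G a : C^∞⟮𝓡 m, P; ℝ⟯) := by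
    have hall : ∀ᶠ w in 𝓝 z, ∀ a, Y a w = φ w a - φ z a ∧ G a w = g a (φ w) :=
      eventually_all.2 fun a => (hY a).and (hG a)
    filter_upwards [hall, hcont.eventually hf', hsrc] with w hw hw2 hw3
    have h0 : f' (φ z) = F z := by
      rw [hf'.self_of_nhds]; simp [hφ]
    have h1 : f' (φ w) = F w := by
      rw [hw2]; simp [φ.left_inv hw3]
    rw [← h1, hfg (φ w), h0]
    have hsum : (∑ a, Y a * G a : C^∞⟮𝓡 m, P; ℝ⟯) w = ∑ a, Y a w * G a w := by
      have := map_sum (ContMDiffMap.evalRingHom w :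
        C^∞⟮𝓡 m, P; ℝ⟯ →+* ℝ) (fun a => Y a * G a) Finset.univ
      exact this
    change _ = F z * 1 + (∑ a, Y a * G a : C^∞⟮𝓡 m, P; ℝ⟯) w
    rw [hsum]
    simp [hw]
  have hDF : D F = ∑ a, D (Y a) * fderiv ℝ f' (φ z) (EuclideanSpace.single a 1) := by
    rw [derivation_congr D z hD hFeq, map_add, derivation_const D z hD, map_sum, zero_add]
    refine Finset.sum_congr rfl fun a _ => ?_
    rw [hD, (hY a).self_of_nhds, (hG a).self_of_nhds, ← hg0]
    simp
  have hmf : (mfderiv (𝓡 m) 𝓘(ℝ, ℝ) F z : EuclideanSpace ℝ (Fin m) →L[ℝ] ℝ) = fderiv ℝ f' (φ z) := by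
    have hmd : MDifferentiableAt (𝓡 m) 𝓘(ℝ, ℝ) F z := F.contMDiff.mdifferentiableAt (by simp)
    rw [hmd.mfderiv]
    simp only [mfld_simps, fderivWithin_univ]
    exact (Filter.EventuallyEq.fderiv_eq hf').symm
  rw [hDF]
  change (mfderiv (𝓡 m) 𝓘(ℝ, ℝ) F z : EuclideanSpace ℝ (Fin m) →L[ℝ] ℝ) _ = _
  have : (WithLp.toLp 2 fun a => D (Y a) : EuclideanSpace ℝ (Fin m)) = ∑ a, D (Y a) • EuclideanSpace.single a (1:ℝ) := by
    ext i
    simp [Pi.single_apply]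
  rw [this, hmf]
  exact (map_sum (fderiv ℝ f' (φ z)) _ _).trans (by simp)

end derivations

end aux

/-! ### Poisson manifolds -/

/-- A Poisson structure on a smooth `m`-dimensional manifold `P`: a Lie bracket on `C^∞(P)` that is
a derivation in each entry. (The derivation property is stated in the first entry; the one in the
second entry follows by antisymmetry.) -/
structure PoissonStructure (m : ℕ) (P : Type u) [TopologicalSpace P]
    [ChartedSpace (EuclideanSpace ℝ (Fin m)) P] where
  /-- the Poisson bracket `{F, G}` -/
  bracket : C^∞⟮𝓡 m, P; ℝ⟯ →ₗ[ℝ] C^∞⟮𝓡 m, P; ℝ⟯ →ₗ[ℝ] C^∞⟮𝓡 m, P; ℝ⟯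
  bracket_self : ∀ F, bracket F F = 0
  jacobi : ∀ F G K,
    bracket F (bracket G K) + bracket G (bracket K F) + bracket K (bracket F G) = 0
  leibniz : ∀ F G K, bracket (F * G) K = F * bracket G K + bracket F K * G

section Defs

variable {m : ℕ} {P : Type u} [TopologicalSpace P] [ChartedSpace (EuclideanSpace ℝ (Fin m)) P]

/-- The differential `dF(z)` of a smooth function, as a covector at `z`. -/
noncomputable def differential (F : C^∞⟮𝓡 m, P; ℝ⟯) (z : P) :
    TangentSpace (𝓡 m) z →L[ℝ] ℝ :=
  mfderiv (𝓡 m) 𝓘(ℝ, ℝ) F z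

/-- Tangent vectors are determined by their action on global smooth functions. -/
theorem tangent_ext [T2Space P] [IsManifold (𝓡 m) ∞ P] {z : P} {v w : TangentSpace (𝓡 m) z}
    (h : ∀ F : C^∞⟮𝓡 m, P; ℝ⟯, differential F z v = differential F z w) : v = w := by
  set φ := chartAt (EuclideanSpace ℝ (Fin m)) z with hφ
  have hφs : ContMDiffOn (𝓡 m) (𝓡 m) ∞ φ φ.source := contMDiffOn_chart
  have hmd : MDifferentiableAt (𝓡 m) (𝓡 m) φ z :=
    (hφs.contMDiffAt (chart_source_mem_nhds _ z)).mdifferentiableAt (by simp)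
  have key : ∀ a : Fin m, (id v : EuclideanSpace ℝ (Fin m)) a =
      (id w : EuclideanSpace ℝ (Fin m)) a := by
    intro a
    have hsm : ContMDiff (𝓡 m) 𝓘(ℝ, ℝ) ∞ (fun y : EuclideanSpace ℝ (Fin m) => y a) := by
      apply ContDiff.contMDiff
      fun_prop
    obtain ⟨Y, hY⟩ := exists_extension z _ (chart_source_mem_nhds _ z) (hsm.comp_contMDiffOn hφs)
    have hd : (mfderiv (𝓡 m) 𝓘(ℝ, ℝ) Y z : EuclideanSpace ℝ (Fin m) →L[ℝ] ℝ) =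
        EuclideanSpace.proj a := by
      have hYd : MDifferentiableAt (𝓡 m) 𝓘(ℝ, ℝ) Y z := Y.contMDiff.mdifferentiableAt (by simp)
      rw [hYd.mfderiv]
      simp only [mfld_simps, fderivWithin_univ]
      have hcont : Filter.Tendsto φ.symm (nhds (φ z)) (nhds z) := by
        have := φ.symm.continuousAt (x := φ z) (by simp [hφ])
        rwa [ContinuousAt, φ.left_inv (mem_chart_source _ z)] at this
      have : (Y : P → ℝ) ∘ φ.symm =ᶠ[nhds (φ z)]
          (EuclideanSpace.proj a : EuclideanSpace ℝ (Fin m) →L[ℝ] ℝ) := by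
        filter_upwards [hcont.eventually hY, chart_target_mem_nhds _ z] with y hy hyt
        simp only [Function.comp_apply, hy]
        rw [φ.right_inv hyt]
        rfl
      exact this.fderiv_eq.trans (ContinuousLinearMap.fderiv _)
    have := h Y
    change (mfderiv (𝓡 m) 𝓘(ℝ, ℝ) Y z : EuclideanSpace ℝ (Fin m) →L[ℝ] ℝ) v =
      (mfderiv (𝓡 m) 𝓘(ℝ, ℝ) Y z : EuclideanSpace ℝ (Fin m) →L[ℝ] ℝ) w at this
    rw [hd] at this
    exact this
  have h2 : (id v : EuclideanSpace ℝ (Fin m)) = (id w : EuclideanSpace ℝ (Fin m)) := PiLp.ext key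
  exact h2

/-- The tangent space at `ι x` of the immersed submanifold `ι : N → P`. -/
noncomputable def immersedTangentSpace (m k : ℕ) {P : Type u} [TopologicalSpace P]
    [ChartedSpace (EuclideanSpace ℝ (Fin m)) P] {N : Type v} [TopologicalSpace N]
    [ChartedSpace (EuclideanSpace ℝ (Fin k)) N] (ι : N → P) (x : N) :
    Submodule ℝ (TangentSpace (𝓡 m) (ι x)) :=
  LinearMap.range (mfderiv (𝓡 k) (𝓡 m) ι x).toLinearMap

namespace PoissonStructure

variable (π : PoissonStructure m P)

theorem exists_hamiltonianVector [T2Space P] [IsManifold (𝓡 m) ∞ P] (H : C^∞⟮𝓡 m, P; ℝ⟯) (z : P) :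
    ∃ v : TangentSpace (𝓡 m) z, ∀ F : C^∞⟮𝓡 m, P; ℝ⟯, differential F z v = π.bracket F H z :=
  exists_tangent_of_derivation
    { toFun := fun F => π.bracket F H z
      map_add' := fun F G => by rw [map_add]; rfl
      map_smul' := fun c F => by rw [map_smul]; rfl } z
    (fun F G => by
      change π.bracket (F * G) H z = F z * π.bracket G H z + π.bracket F H z * G z
      rw [π.leibniz]; rfl)

variable [T2Space P] [IsManifold (𝓡 m) ∞ P]

/-- The Hamiltonian vector field `X_H`, determined by `X_H[F] = {F, H}` for all `F`. -/
noncomputable def hamiltonianVectorField (H : C^∞⟮𝓡 m, P; ℝ⟯) (z : P) : TangentSpace (𝓡 m) z :=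
  (π.exists_hamiltonianVector H z).choose

theorem differential_hamiltonianVectorField (F H : C^∞⟮𝓡 m, P; ℝ⟯) (z : P) :
    differential F z (π.hamiltonianVectorField H z) = π.bracket F H z :=
  (π.exists_hamiltonianVector H z).choose_spec F

/-- The characteristic distribution: its fibre at `z` is `{X_H(z) | H ∈ C^∞(P)}`. -/
noncomputable def characteristicSpace (z : P) : Submodule ℝ (TangentSpace (𝓡 m) z) where
  carrier := Set.range fun H => π.hamiltonianVectorField H z
  add_mem' := by
    rintro _ _ ⟨H, rfl⟩ ⟨K, rfl⟩
    refine ⟨H + K, tangent_ext fun F => ?_⟩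
    simp only [map_add, differential_hamiltonianVectorField]
    rfl
  zero_mem' := by
    refine ⟨0, tangent_ext fun F => ?_⟩
    simp only [map_zero, differential_hamiltonianVectorField]
    rfl
  smul_mem' := by
    rintro c _ ⟨H, rfl⟩
    refine ⟨c • H, tangent_ext fun F => ?_⟩
    simp only [map_smul, differential_hamiltonianVectorField]
    rfl

/-- A point is regular if all symplectic leaves near it have the same dimension; the dimension of
the leaf through `w` is the dimension of the fibre at `w` of the characteristic distribution. -/
def IsRegularPoint (z : P) : Prop :=
  ∃ d : ℕ, ∀ᶠ w in nhds z, Module.finrank ℝ (π.characteristicSpace w) = d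

/-- `ι : N → P` is an (injectively immersed) integral manifold of the characteristic
distribution. -/
structure IsIntegralManifold (k : ℕ) {N : Type v} [TopologicalSpace N]
    [ChartedSpace (EuclideanSpace ℝ (Fin k)) N] (ι : N → P) : Prop where
  smooth : ContMDiff (𝓡 k) (𝓡 m) ∞ ι
  injective : Function.Injective ι
  immersion : ∀ x, Function.Injective (mfderiv (𝓡 k) (𝓡 m) ι x)
  tangent_eq : ∀ x, immersedTangentSpace m k ι x = π.characteristicSpace (ι x)

/-- `ι : N → P` is a symplectic leaf: a maximal connected integral manifold of the characteristic
distribution. -/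
structure IsSymplecticLeaf (k : ℕ) {N : Type v} [TopologicalSpace N]
    [ChartedSpace (EuclideanSpace ℝ (Fin k)) N] (ι : N → P) : Prop
    extends π.IsIntegralManifold k ι where
  connected : ConnectedSpace N
  maximal : ∀ (k' : ℕ) (N' : Type u) [TopologicalSpace N']
    [ChartedSpace (EuclideanSpace ℝ (Fin k')) N'] [IsManifold (𝓡 k') ∞ N'] [ConnectedSpace N']
    (ι' : N' → P), π.IsIntegralManifold k' ι' → (Set.range ι' ∩ Set.range ι).Nonempty →
      Set.range ι' ⊆ Set.range ι

/-- A leaf is regular if it consists of regular points. -/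
def IsRegularLeaf {N : Type v} (ι : N → P) : Prop :=
  ∀ x, π.IsRegularPoint (ι x)

end PoissonStructure

/-! ### Linearization at an equilibrium -/

/-- `Φ t x` is a smooth local flow of the vector field `X` around the point `z`. -/
def IsLocalFlow (X : (w : P) → TangentSpace (𝓡 m) w) (z : P) (Φ : ℝ → P → P) : Prop :=
  ∃ ε > 0, ∃ U ∈ nhds z,
    ContMDiffOn (𝓘(ℝ, ℝ).prod (𝓡 m)) (𝓡 m) ∞ (fun p : ℝ × P => Φ p.1 p.2)
      (Set.Ioo (-ε) ε ×ˢ U) ∧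
    ∀ w ∈ U, Φ 0 w = w ∧ IsMIntegralCurveOn (fun t => Φ t w) X (Set.Ioo (-ε) ε)

/-- The linearization `L v = d/dt|₀ T_zΦ_t(v)` of a vector field with flow `Φ` at an equilibrium
`z`. Since `Φ t z = z`, every `T_zΦ_t` is an endomorphism of `T_zP`, whose underlying space is the
model space. -/
noncomputable def linearization (Φ : ℝ → P → P) (z : P) :
    TangentSpace (𝓡 m) z →L[ℝ] TangentSpace (𝓡 m) z :=
  deriv (fun t : ℝ => (mfderiv (𝓡 m) (𝓡 m) (Φ t) z :
    EuclideanSpace ℝ (Fin m) →L[ℝ] EuclideanSpace ℝ (Fin m))) 0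

/-- The real vectors in the unstable subspace of an endomorphism: the sum of the generalized
eigenspaces of the complexification for the eigenvalues with positive real part. -/
noncomputable def unstableSpace {V : Type*} [AddCommGroup V] [Module ℝ V] (L : V →ₗ[ℝ] V) : Set V :=
  {u | (1 : ℂ) ⊗ₜ[ℝ] u ∈ ⨆ μ : {μ : ℂ // 0 < μ.re},
    Module.End.maxGenEigenspace (L.baseChange ℂ : Module.End ℂ (ℂ ⊗[ℝ] V)) μ}

/-! ### Darboux-Weinstein coordinates -/

/-- The matrix `J`. -/
def symplecticJ (n : ℕ) : Matrix (Fin n ⊕ Fin n) (Fin n ⊕ Fin n) ℝ :=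
  Matrix.fromBlocks 0 1 (-1) 0

/-- `{f, g}(w) = c` for functions `f`, `g` that are smooth near `w`: the bracket is local, so it is
computed on arbitrary global functions with the same germs at `w`. -/
def PoissonStructure.HasLocalBracket (π : PoissonStructure m P) (f g : P → ℝ) (w : P) (c : ℝ) :
    Prop :=
  ∀ F G : C^∞⟮𝓡 m, P; ℝ⟯, (F : P → ℝ) =ᶠ[nhds w] f → (G : P → ℝ) =ᶠ[nhds w] g →
    π.bracket F G w = c

/-- A Darboux-Weinstein chart around `z₀`, with coordinates `((q, p), z)`, indexed by
`(Fin n ⊕ Fin n) ⊕ Fin r`. -/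
structure DarbouxWeinsteinChart (π : PoissonStructure m P) (z₀ : P) (n r : ℕ) where
  chart : OpenPartialHomeomorph P (EuclideanSpace ℝ (Fin m))
  mem_maximalAtlas : chart ∈ IsManifold.maximalAtlas (𝓡 m) ∞ P
  mem_source : z₀ ∈ chart.source
  map_base : chart z₀ = 0
  /-- the labelling of the `m = 2n + r` coordinates as `q`, `p`, and `z` -/
  index : (Fin n ⊕ Fin n) ⊕ Fin r ≃ Fin m
  /-- the matrix of the transverse Poisson tensor, `{z^k, z^l} = R^{kl}(z)` -/
  R : (Fin r → ℝ) → Matrix (Fin r) (Fin r) ℝ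
  R_zero : R 0 = 0
  /-- the relations `{q, q} = {p, p} = {q, z} = {p, z} = 0`, `{q^i, p_j} = δ^i_j`, and
  `{z^k, z^l} = R^{kl}(z)` on the domain of the chart -/
  bracket_coord : ∀ w ∈ chart.source, ∀ a b,
    π.HasLocalBracket (fun w' => chart w' (index a)) (fun w' => chart w' (index b)) w
      (Matrix.fromBlocks (symplecticJ n) 0 0
        (R fun k => chart w (index (Sum.inr k))) a b)

/-- The partial derivative `∂f/∂y^a`. -/
noncomputable def partialDeriv (a : Fin m) (f : EuclideanSpace ℝ (Fin m) → ℝ)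
    (y : EuclideanSpace ℝ (Fin m)) : ℝ :=
  fderiv ℝ f y (EuclideanSpace.single a 1)

namespace DarbouxWeinsteinChart

variable {π : PoissonStructure m P} {z₀ : P} {n r : ℕ} (c : DarbouxWeinsteinChart π z₀ n r)

/-- A function in the coordinates of the chart. -/
noncomputable def localRep (H : C^∞⟮𝓡 m, P; ℝ⟯) (y : EuclideanSpace ℝ (Fin m)) : ℝ :=
  H (c.chart.symm y)

/-- The block `S^i_j = ∑ₚ J^{ip} ∂²H/∂x^p∂x^j (0, 0)`. -/
noncomputable def blockS (H : C^∞⟮𝓡 m, P; ℝ⟯) : Matrix (Fin n ⊕ Fin n) (Fin n ⊕ Fin n) ℝ :=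
  Matrix.of fun i j => ∑ p, symplecticJ n i p *
    partialDeriv (c.index (Sum.inl p)) (partialDeriv (c.index (Sum.inl j)) (c.localRep H)) 0

/-- The block `Q^i_l = ∑ₚ J^{ip} ∂²H/∂x^p∂z^l (0, 0)`. -/
noncomputable def blockQ (H : C^∞⟮𝓡 m, P; ℝ⟯) : Matrix (Fin n ⊕ Fin n) (Fin r) ℝ :=
  Matrix.of fun i l => ∑ p, symplecticJ n i p *
    partialDeriv (c.index (Sum.inl p)) (partialDeriv (c.index (Sum.inr l)) (c.localRep H)) 0

/-- The transverse block `P^k_l = ∑ₚ ∂R^{kp}/∂z^l (0) ∂H/∂z^p (0, 0)`. -/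
noncomputable def blockP (H : C^∞⟮𝓡 m, P; ℝ⟯) : Matrix (Fin r) (Fin r) ℝ :=
  Matrix.of fun k l => ∑ p, fderiv ℝ (fun z => c.R z k p) 0 (Pi.single l 1) *
    partialDeriv (c.index (Sum.inr p)) (c.localRep H) 0

/-- The matrix, in the coordinates of the chart, of an endomorphism `L` of `T_{z₀}P`: its entry
`(a, b)` is `dy^a(L (∂/∂y^b))`. -/
noncomputable def coordMatrix (L : TangentSpace (𝓡 m) z₀ →L[ℝ] TangentSpace (𝓡 m) z₀) :
    Matrix ((Fin n ⊕ Fin n) ⊕ Fin r) ((Fin n ⊕ Fin n) ⊕ Fin r) ℝ :=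
  Matrix.of fun a b =>
    (EuclideanSpace.proj (c.index a) : EuclideanSpace ℝ (Fin m) →L[ℝ] ℝ)
      (mfderiv (𝓡 m) (𝓡 m) c.chart z₀ (L ((mfderiv (𝓡 m) (𝓡 m) c.chart.symm (c.chart z₀) :
          EuclideanSpace ℝ (Fin m) →L[ℝ] EuclideanSpace ℝ (Fin m))
        (EuclideanSpace.single (c.index b) 1))))

end DarbouxWeinsteinChart

/-- The eigenvalues in `ℂ` of a real square matrix, counted with algebraic multiplicity. -/
noncomputable def complexEigenvalues {α : Type*} [Fintype α] [DecidableEq α] (A : Matrix α α ℝ) :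
    Multiset ℂ :=
  (A.map (algebraMap ℝ ℂ)).charpoly.roots

end Defs

end PoissonLin

/-!
Differentiating `d/dt (F ∘ Φ_t) = {F, H} ∘ Φ_t` at the equilibrium shows that `dF ∘ L = d{F, H}` for
every `F`. If `dA` annihilates `𝓔` at `z_e`, then all the brackets `{A, G}` and `{F, H}` vanish
there. Choose `Fᵢ`, `Gⱼ` with `{Fᵢ, Gⱼ}(z_e) = δᵢⱼ` and as many of each as the rank of `𝓔`. Since
the rank is locally constant, Cramer's rule in `𝓔` expresses `det ({Fᵢ, Gⱼ}) {A, H}` near `z_e` as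
`∑ⱼ {A, Gⱼ} cⱼ`, where the `cⱼ` are combinations of the `{Fᵢ, H}`; both factors vanish at `z_e`, so
`dA ∘ L = d{A, H}` vanishes there. Hence the range of `L` lies in `𝓔`, and with it every generalized
eigenspace for a nonzero eigenvalue. In a Darboux-Weinstein chart the matrix of `L` is
`∂{y^a, H}/∂y^b`, and `𝒫 = 0` because the differentials of the transverse coordinates annihilate
`𝓔`; the spectrum of `L` is then that of a block triangular matrix.
-/

namespace PoissonLin

open Filter Topology

/-! ### Linear algebra -/

theorem maxGenEigenspace_le_range {K V : Type*} [Field K] [AddCommGroup V] [Module K V]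
    (f : Module.End K V) {μ : K} (hμ : μ ≠ 0) : f.maxGenEigenspace μ ≤ LinearMap.range f := by
  intro x hx
  obtain ⟨k, hk⟩ := (Module.End.mem_maxGenEigenspace f μ x).1 hx
  clear hx
  induction k generalizing x with
  | zero =>
    obtain rfl : x = 0 := by simpa using hk
    exact zero_mem _
  | succ k ih =>
    have hx : f x - μ • x ∈ LinearMap.range f := ih (by rwa [pow_succ] at hk)
    have hμx : μ • x ∈ LinearMap.range f := by
      simpa using sub_mem (LinearMap.mem_range_self f x) hx
    exact ((LinearMap.range f).smul_mem_iff hμ).1 hμx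

theorem range_baseChange_le {R M M' : Type*} (A : Type*) [CommSemiring R] [Semiring A]
    [Algebra R A] [AddCommMonoid M] [Module R M] [AddCommMonoid M'] [Module R M']
    {f : M →ₗ[R] M'} {W : Submodule R M'} (hf : LinearMap.range f ≤ W) :
    LinearMap.range (f.baseChange A) ≤ W.baseChange A := by
  have hfac : f = W.subtype ∘ₗ f.codRestrict W fun x => hf (LinearMap.mem_range_self f x) := rfl
  rw [hfac, LinearMap.baseChange_comp]
  exact LinearMap.range_comp_le_range _ _

theorem one_tmul_mem_baseChange_iff {R M : Type*} (A : Type*) [CommRing R] [Ring A] [Algebra R A]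
    [Module.FaithfullyFlat R A] [AddCommGroup M] [Module R M] {W : Submodule R M} {x : M} :
    (1 : A) ⊗ₜ[R] x ∈ W.baseChange A ↔ x ∈ W := by
  refine ⟨fun hx => ?_, Submodule.tmul_mem_baseChange_of_mem 1⟩
  have hker : W.baseChange A ≤ LinearMap.ker (W.mkQ.baseChange A) := by
    rw [Submodule.baseChange, LinearMap.range_le_ker_iff, ← LinearMap.baseChange_comp,
      LinearMap.range_le_ker_iff.1 (by simp), LinearMap.baseChange_zero]
  have hzero : (1 : A) ⊗ₜ[R] W.mkQ x = 0 := hker hx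
  rwa [Module.FaithfullyFlat.one_tmul_eq_zero_iff, W.mkQ_apply,
    Submodule.Quotient.mk_eq_zero] at hzero

theorem unstableSpace_subset {V : Type*} [AddCommGroup V] [Module ℝ V] {f : V →ₗ[ℝ] V}
    {W : Submodule ℝ V} (hf : LinearMap.range f ≤ W) : unstableSpace f ⊆ W := by
  intro x hx
  have hle : ∀ μ : {μ : ℂ // 0 < μ.re},
      Module.End.maxGenEigenspace (f.baseChange ℂ) μ ≤ W.baseChange ℂ := fun μ =>
    (maxGenEigenspace_le_range _ fun h0 => μ.2.ne' (by rw [h0, Complex.zero_re])).trans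
      (range_baseChange_le ℂ hf)
  exact (one_tmul_mem_baseChange_iff ℂ).1 (iSup_le hle hx)

theorem complexEigenvalues_fromBlocks_zero {α β : Type*} [Fintype α] [DecidableEq α] [Fintype β]
    [DecidableEq β] (S : Matrix α α ℝ) (Q : Matrix α β ℝ) :
    complexEigenvalues (Matrix.fromBlocks S Q 0 0) =
      complexEigenvalues S + Multiset.replicate (Fintype.card β) 0 := by
  rw [complexEigenvalues, Matrix.fromBlocks_map, Matrix.map_zero _ (map_zero _),
    Matrix.map_zero _ (map_zero _), Matrix.charpoly_fromBlocks_zero₂₁, Matrix.charpoly_zero,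
    Polynomial.roots_mul ((Matrix.charpoly_monic _).mul (Polynomial.monic_X_pow _)).ne_zero,
    Polynomial.roots_X_pow, Multiset.nsmul_singleton, complexEigenvalues]

theorem hasEigenvalue_baseChange_iff {ι V : Type*} [Fintype ι] [DecidableEq ι] [AddCommGroup V]
    [Module ℝ V] (b : Module.Basis ι ℝ V) (f : Module.End ℝ V) (μ : ℂ) :
    Module.End.HasEigenvalue (f.baseChange ℂ : Module.End ℂ (ℂ ⊗[ℝ] V)) μ ↔
      μ ∈ complexEigenvalues (LinearMap.toMatrix b b f) := by
  have := b.finiteDimensional_of_finite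
  rw [Module.End.hasEigenvalue_iff_isRoot_charpoly, LinearMap.charpoly_baseChange,
    ← LinearMap.charpoly_toMatrix f b, complexEigenvalues,
    Polynomial.mem_roots (Matrix.charpoly_monic _).ne_zero, Matrix.charpoly_map]

theorem det_smul_eq_sum_adjugate_mulVec_smul {ι R M : Type*} [Fintype ι] [DecidableEq ι]
    [CommRing R] [AddCommGroup M] [Module R M] (b : Module.Basis ι R M)
    (β : ι → M →ₗ[R] R) (x : ι → M) (y : M) :
    (Matrix.of fun i j => β i (x j)).det • y =
      ∑ j, ((Matrix.of fun i j => β i (x j)).adjugate *ᵥ fun i => β i y) j • x j := by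
  set B : Matrix ι ι R := Matrix.of fun i k => β i (b k)
  set X : Matrix ι ι R := Matrix.of fun k j => b.repr (x j) k
  have hβ : ∀ y, (fun i => β i y) = B *ᵥ b.repr y := fun y => by
    ext i
    conv_lhs => rw [← b.sum_repr y, map_sum]
    simp only [map_smul, smul_eq_mul, mul_comm]
    rfl
  have hM : (Matrix.of fun i j => β i (x j)) = B * X := by
    ext i j
    exact congrFun (hβ (x j)) i
  rw [hM]
  refine b.repr.injective (DFunLike.coe_injective ?_)
  have hX : ∀ v : ι → R, ⇑(b.repr (∑ j, v j • x j)) = X *ᵥ v := fun v => by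
    ext k
    simp [X, Matrix.mulVec, dotProduct, Finsupp.finsetSum_apply, mul_comm]
  rw [hX, hβ, Matrix.mulVec_mulVec, Matrix.mulVec_mulVec, Matrix.adjugate_mul_distrib, map_smul,
    Finsupp.coe_smul]
  have hdet : X * (X.adjugate * B.adjugate) * B = (B * X).det • (1 : Matrix ι ι R) := by
    rw [← mul_assoc, Matrix.mul_adjugate, Matrix.smul_mul, Matrix.one_mul, Matrix.smul_mul,
      Matrix.adjugate_mul, smul_smul, Matrix.det_mul, mul_comm]
  rw [hdet, Matrix.smul_mulVec, Matrix.one_mulVec]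

/-! ### Differentials of functions -/

section Differential

instance finiteDimensional_tangentSpace {𝕜 E M H : Type*} [NontriviallyNormedField 𝕜]
    [NormedAddCommGroup E] [NormedSpace 𝕜 E] [FiniteDimensional 𝕜 E] [TopologicalSpace H]
    (I : ModelWithCorners 𝕜 E H) [TopologicalSpace M] [ChartedSpace H M] (x : M) :
    FiniteDimensional 𝕜 (TangentSpace I x) :=
  inferInstanceAs (FiniteDimensional 𝕜 E)

variable {m : ℕ} {P : Type u} [TopologicalSpace P] [ChartedSpace (EuclideanSpace ℝ (Fin m)) P]

theorem hasMFDerivAt_differential (F : C^∞⟮𝓡 m, P; ℝ⟯) (z : P) :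
    HasMFDerivAt (𝓡 m) 𝓘(ℝ, ℝ) F z (differential F z) :=
  (F.contMDiff.mdifferentiableAt (by simp)).hasMFDerivAt

theorem differential_congr {F G : C^∞⟮𝓡 m, P; ℝ⟯} {z : P} (h : (F : P → ℝ) =ᶠ[𝓝 z] G) :
    differential F z = differential G z :=
  h.mfderiv_eq

theorem differential_zero (z : P) : differential (0 : C^∞⟮𝓡 m, P; ℝ⟯) z = 0 :=
  mfderiv_const

theorem differential_add (F G : C^∞⟮𝓡 m, P; ℝ⟯) (z : P) :
    differential (F + G) z = differential F z + differential G z :=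
  ((hasMFDerivAt_differential F z).add (hasMFDerivAt_differential G z)).mfderiv

theorem differential_smul (c : ℝ) (F : C^∞⟮𝓡 m, P; ℝ⟯) (z : P) :
    differential (c • F) z = c • differential F z :=
  ((hasMFDerivAt_differential F z).const_smul c).mfderiv

theorem differential_mul (F G : C^∞⟮𝓡 m, P; ℝ⟯) (z : P) :
    differential (F * G) z = F z • differential G z + G z • differential F z :=
  ((hasMFDerivAt_differential F z).mul (hasMFDerivAt_differential G z)).mfderiv

theorem differential_dotProduct_eq_zero {ι : Type*} [Fintype ι] {u v : ι → C^∞⟮𝓡 m, P; ℝ⟯} {z : P}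
    (hu : ∀ i, u i z = 0) (hv : ∀ i, v i z = 0) : differential (u ⬝ᵥ v) z = 0 := by
  refine Finset.sum_induction _ (fun F => differential F z = 0) (fun F G hF hG => ?_)
    (differential_zero z) fun i _ => ?_
  · rw [differential_add, hF, hG, add_zero]
  · rw [differential_mul, hu, hv, zero_smul, zero_smul, add_zero]

variable [T2Space P] [IsManifold (𝓡 m) ∞ P]

theorem exists_differential_eq {z : P} (β : TangentSpace (𝓡 m) z →ₗ[ℝ] ℝ) :
    ∃ F : C^∞⟮𝓡 m, P; ℝ⟯, ∀ v, differential F z v = β v := by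
  let D : C^∞⟮𝓡 m, P; ℝ⟯ →ₗ[ℝ] Module.Dual ℝ (TangentSpace (𝓡 m) z) :=
    { toFun := fun F => (differential F z).toLinearMap
      map_add' := fun F G => by rw [differential_add]; rfl
      map_smul' := fun c F => by rw [differential_smul]; rfl }
  have hsep : (LinearMap.range D).dualCoannihilator = ⊥ := by
    refine (Submodule.eq_bot_iff _).2 fun v hv => tangent_ext fun F => ?_
    rw [map_zero]
    exact (Submodule.mem_dualCoannihilator v).1 hv (D F) (LinearMap.mem_range_self D F)
  have hD : LinearMap.range D = ⊤ := by
    rw [← Subspace.dualCoannihilator_dualAnnihilator_eq (W := LinearMap.range D), hsep,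
      Submodule.dualAnnihilator_bot]
  obtain ⟨F, hF⟩ := LinearMap.range_eq_top.1 hD β
  exact ⟨F, DFunLike.congr_fun hF⟩

end Differential

/-! ### Regular points -/

namespace PoissonStructure

variable {m : ℕ} {P : Type u} [TopologicalSpace P] [T2Space P]
  [ChartedSpace (EuclideanSpace ℝ (Fin m)) P] [IsManifold (𝓡 m) ∞ P]
  (π : PoissonStructure m P)

theorem hamiltonianVectorField_mem (H : C^∞⟮𝓡 m, P; ℝ⟯) (z : P) :
    π.hamiltonianVectorField H z ∈ π.characteristicSpace z :=
  ⟨H, rfl⟩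

-- Cramer's rule in `𝓔_w`, for the functionals `dFᵢ` and the vectors `X_{Gⱼ}` and `X_H`.
theorem det_mul_bracket_apply {ι : Type*} [Fintype ι] [DecidableEq ι]
    (F G : ι → C^∞⟮𝓡 m, P; ℝ⟯) (A H : C^∞⟮𝓡 m, P; ℝ⟯) {w : P}
    (hw : Module.finrank ℝ (π.characteristicSpace w) = Fintype.card ι) :
    ((Matrix.of fun i j => π.bracket (F i) (G j)).det * π.bracket A H) w =
      ((fun j => π.bracket A (G j)) ⬝ᵥ
        ((Matrix.of fun i j => π.bracket (F i) (G j)).adjugate *ᵥ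
          fun i => π.bracket (F i) H)) w := by
  set M : Matrix ι ι C^∞⟮𝓡 m, P; ℝ⟯ := Matrix.of fun i j => π.bracket (F i) (G j)
  let ev : C^∞⟮𝓡 m, P; ℝ⟯ →+* ℝ := ContMDiffMap.evalRingHom w
  let dE (K : C^∞⟮𝓡 m, P; ℝ⟯) : π.characteristicSpace w →ₗ[ℝ] ℝ :=
    (differential K w).toLinearMap ∘ₗ (π.characteristicSpace w).subtype
  let X (K : C^∞⟮𝓡 m, P; ℝ⟯) : π.characteristicSpace w :=
    ⟨π.hamiltonianVectorField K w, π.hamiltonianVectorField_mem K w⟩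
  have hdX : ∀ K K', dE K (X K') = ev (π.bracket K K') := fun K K' =>
    π.differential_hamiltonianVectorField K K' w
  let b := (Module.finBasis ℝ (π.characteristicSpace w)).reindex
    (Fintype.equivOfCardEq ((Fintype.card_fin _).trans hw))
  have hcramer := congrArg (dE A) (det_smul_eq_sum_adjugate_mulVec_smul b
    (fun i => dE (F i)) (fun j => X (G j)) (X H))
  have hM : (Matrix.of fun i j => ev (π.bracket (F i) (G j))) = ev.mapMatrix M := rfl
  simp only [map_smul, map_sum, hdX, smul_eq_mul, hM, ← RingHom.map_adjugate,
    ← RingHom.map_det] at hcramer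
  have hev : ∀ K : C^∞⟮𝓡 m, P; ℝ⟯, K w = ev K := fun _ => rfl
  rw [hev, hev, map_mul, RingHom.map_dotProduct, hcramer]
  exact Finset.sum_congr rfl fun j _ => (mul_comm _ _).trans
    (congrArg (ev (π.bracket A (G j)) * ·) (RingHom.map_mulVec ev M.adjugate _ j).symm)

theorem exists_bracket_apply_eq_one (z : P) :
    ∃ F G : Fin (Module.finrank ℝ (π.characteristicSpace z)) → C^∞⟮𝓡 m, P; ℝ⟯,
      (Matrix.of fun i j => π.bracket (F i) (G j) z) = 1 := by
  let b := Module.finBasis ℝ (π.characteristicSpace z)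
  choose G hG using fun j => (b j).2
  have hdual : ∀ i, ∃ F : C^∞⟮𝓡 m, P; ℝ⟯, ∀ v : π.characteristicSpace z,
      differential F z v = b.coord i v := by
    intro i
    obtain ⟨β, hβ⟩ := LinearMap.exists_extend (b.coord i)
    obtain ⟨F, hF⟩ := exists_differential_eq β
    exact ⟨F, fun v => (hF v).trans (DFunLike.congr_fun hβ v)⟩
  choose F hF using hdual
  refine ⟨F, G, ?_⟩
  ext i j
  rw [Matrix.of_apply, ← π.differential_hamiltonianVectorField]
  refine (congrArg (differential (F i) z) (hG j)).trans ?_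
  rw [hF, b.coord_apply, b.repr_self, Matrix.one_apply, Finsupp.single_apply]
  exact if_congr eq_comm rfl rfl

theorem differential_bracket_eq_zero {z : P} (hz : π.IsRegularPoint z) {A H : C^∞⟮𝓡 m, P; ℝ⟯}
    (hA : ∀ G, π.bracket A G z = 0) (hH : ∀ F, π.bracket F H z = 0) :
    differential (π.bracket A H) z = 0 := by
  obtain ⟨d, hd⟩ := hz
  obtain rfl := hd.self_of_nhds
  obtain ⟨F, G, hFG⟩ := π.exists_bracket_apply_eq_one z
  let ev : C^∞⟮𝓡 m, P; ℝ⟯ →+* ℝ := ContMDiffMap.evalRingHom z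
  set M : Matrix _ _ C^∞⟮𝓡 m, P; ℝ⟯ := Matrix.of fun i j => π.bracket (F i) (G j)
  have hdet : M.det z = 1 := by
    have hM : ev.mapMatrix M = 1 := hFG
    exact (ev.map_det M).trans (by rw [hM, Matrix.det_one])
  have hadj : ∀ j, (M.adjugate *ᵥ fun i => π.bracket (F i) H) j z = 0 := fun j => by
    have hHz : (ev ∘ fun i => π.bracket (F i) H) = 0 := funext fun i => hH (F i)
    exact (ev.map_mulVec _ _ j).trans (by rw [hHz, Matrix.mulVec_zero, Pi.zero_apply])
  -- Near `z` the bracket is a combination of products of two functions that vanish at `z`.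
  have hcramer : (M.det * π.bracket A H : C^∞⟮𝓡 m, P; ℝ⟯) =ᶠ[𝓝 z]
      ((fun j => π.bracket A (G j)) ⬝ᵥ (M.adjugate *ᵥ fun i => π.bracket (F i) H) :
        C^∞⟮𝓡 m, P; ℝ⟯) := by
    filter_upwards [hd] with w hw
    exact π.det_mul_bracket_apply F G A H (hw.trans (Fintype.card_fin _).symm)
  have hzero : differential (M.det * π.bracket A H) z = 0 := by
    rw [differential_congr hcramer]
    exact differential_dotProduct_eq_zero (fun j => hA (G j)) hadj
  rwa [differential_mul, hdet, hH A, one_smul, zero_smul, add_zero] at hzero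

theorem range_le_characteristicSpace {z : P} (hz : π.IsRegularPoint z) {H : C^∞⟮𝓡 m, P; ℝ⟯}
    (hH : π.hamiltonianVectorField H z = 0)
    {L : TangentSpace (𝓡 m) z →ₗ[ℝ] TangentSpace (𝓡 m) z}
    (hL : ∀ F v, differential F z (L v) = differential (π.bracket F H) z v) :
    LinearMap.range L ≤ π.characteristicSpace z := by
  rintro _ ⟨v, rfl⟩
  by_contra hv
  obtain ⟨β, hβ, hker⟩ := Submodule.exists_le_ker_of_notMem hv
  obtain ⟨A, hA⟩ := exists_differential_eq β
  have hcrit : differential (π.bracket A H) z = 0 := by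
    refine π.differential_bracket_eq_zero hz (fun G => ?_) fun F => ?_
    · rw [← π.differential_hamiltonianVectorField, hA]
      exact hker (π.hamiltonianVectorField_mem G z)
    · rw [← π.differential_hamiltonianVectorField, hH, map_zero]
  exact hβ (by rw [← hA, hL, hcrit, zero_apply])

end PoissonStructure

/-! ### Derivatives of smooth families of maps -/

section SmoothFamilies

variable {E E' : Type*} [NormedAddCommGroup E] [NormedSpace ℝ E] [NormedAddCommGroup E']
  [NormedSpace ℝ E']

theorem hasDerivAt_fderiv_right {f : ℝ × E → E'} {t₀ : ℝ} {y₀ : E}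
    (hf : ContDiffAt ℝ 2 f (t₀, y₀)) :
    HasDerivAt (fun t => fderiv ℝ (fun y => f (t, y)) y₀)
      (fderiv ℝ (fun y => deriv (fun t => f (t, y)) t₀) y₀) t₀ := by
  have hdiff : ∀ᶠ p in 𝓝 (t₀, y₀), DifferentiableAt ℝ f p :=
    ((hf.of_le one_le_two).eventually (by simp)).mono fun p hp => hp.differentiableAt one_ne_zero
  have hD2 : HasFDerivAt (fderiv ℝ f) (fderiv ℝ (fderiv ℝ f) (t₀, y₀)) (t₀, y₀) :=
    ((hf.fderiv_right (m := 1) one_add_one_eq_two.le).differentiableAt one_ne_zero).hasFDerivAt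
  have hline (y : E) (t : ℝ) : HasDerivAt (fun t : ℝ => (t, y)) ((1 : ℝ), (0 : E)) t :=
    (hasDerivAt_id t).prodMk (hasDerivAt_const t y)
  have hspace : (fun t => fderiv ℝ (fun y => f (t, y)) y₀) =ᶠ[𝓝 t₀]
      fun t => (fderiv ℝ f (t, y₀)).comp (ContinuousLinearMap.inr ℝ ℝ E) := by
    filter_upwards [(hline y₀ t₀).continuousAt.eventually hdiff] with t ht
    exact (ht.hasFDerivAt.comp y₀ (hasFDerivAt_prodMk_right t y₀)).fderiv
  have htime : (fun y => deriv (fun t => f (t, y)) t₀) =ᶠ[𝓝 y₀]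
      fun y => fderiv ℝ f (t₀, y) (1, 0) := by
    filter_upwards [(Continuous.prodMk_right t₀).continuousAt.eventually hdiff] with y hy
    exact (hy.hasFDerivAt.comp_hasDerivAt t₀ (hline y t₀)).deriv
  have hmixed : fderiv ℝ (fun y => deriv (fun t => f (t, y)) t₀) y₀ =
      (fderiv ℝ (fderiv ℝ f) (t₀, y₀) (1, 0)).comp (ContinuousLinearMap.inr ℝ ℝ E) := by
    have hsymm : IsSymmSndFDerivAt ℝ f (t₀, y₀) := hf.isSymmSndFDerivAt (by simp)
    have hder := (hD2.comp y₀ (hasFDerivAt_prodMk_right t₀ y₀)).clm_apply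
      (hasFDerivAt_const ((1 : ℝ), (0 : E)) y₀)
    ext v
    rw [htime.fderiv_eq]
    refine (DFunLike.congr_fun hder.fderiv v).trans ?_
    simpa using hsymm.eq (0, v) (1, 0)
  rw [hmixed]
  refine HasDerivAt.congr_of_eventuallyEq ?_ hspace
  exact (ContinuousLinearMap.precomp E'
    (ContinuousLinearMap.inr ℝ ℝ E)).hasFDerivAt.comp_hasDerivAt t₀
      (hD2.comp_hasDerivAt t₀ (hline y₀ t₀))

variable {M M' : Type*} [TopologicalSpace M] [ChartedSpace E M] [IsManifold 𝓘(ℝ, E) 2 M]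
  [TopologicalSpace M'] [ChartedSpace E' M'] [IsManifold 𝓘(ℝ, E') 2 M']

theorem contDiffAt_chart_comp_symm {Ψ : ℝ → M → M'} {t₀ : ℝ} {z : M}
    (hΨ : ContMDiffAt (𝓘(ℝ, ℝ).prod 𝓘(ℝ, E)) 𝓘(ℝ, E') 2 (Function.uncurry Ψ) (t₀, z)) :
    ContDiffAt ℝ 2 (fun p : ℝ × E => chartAt E' (Ψ t₀ z) (Ψ p.1 ((chartAt E z).symm p.2)))
      (t₀, chartAt E z z) := by
  have hsymm : ContMDiffAt 𝓘(ℝ, E) 𝓘(ℝ, E) 2 (chartAt E z).symm (chartAt E z z) :=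
    contMDiffOn_chart_symm.contMDiffAt (chart_target_mem_nhds E z)
  have hchart : ContMDiffAt 𝓘(ℝ, E') 𝓘(ℝ, E') 2 (chartAt E' (Ψ t₀ z)) (Ψ t₀ z) :=
    contMDiffOn_chart.contMDiffAt (chart_source_mem_nhds E' _)
  have hpair : ContMDiffAt 𝓘(ℝ, ℝ × E) (𝓘(ℝ, ℝ).prod 𝓘(ℝ, E)) 2
      (fun p : ℝ × E => (p.1, (chartAt E z).symm p.2)) (t₀, chartAt E z z) :=
    contDiff_fst.contMDiff.contMDiffAt.prodMk
      (hsymm.comp_of_eq contDiff_snd.contMDiff.contMDiffAt rfl)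
  exact (hchart.comp_of_eq (hΨ.comp_of_eq hpair (by simp)) (by simp)).contDiffAt

theorem hasDerivAt_mfderiv_of_eventually_eq {Ψ : ℝ → M → M'} {z : M} {t₀ : ℝ}
    (hΨ : ContMDiffAt (𝓘(ℝ, ℝ).prod 𝓘(ℝ, E)) 𝓘(ℝ, E') 2 (Function.uncurry Ψ) (t₀, z))
    (hfix : ∀ᶠ t in 𝓝 t₀, Ψ t z = Ψ t₀ z) :
    HasDerivAt (fun t => (mfderiv 𝓘(ℝ, E) 𝓘(ℝ, E') (Ψ t) z : E →L[ℝ] E'))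
      (fderiv ℝ
        (fun y => deriv (fun t => chartAt E' (Ψ t₀ z) (Ψ t ((chartAt E z).symm y))) t₀)
        (chartAt E z z)) t₀ := by
  have hΨ1 : ∀ᶠ p in 𝓝 (t₀, z),
      ContMDiffAt (𝓘(ℝ, ℝ).prod 𝓘(ℝ, E)) 𝓘(ℝ, E') 1 (Function.uncurry Ψ) p := by
    have : IsManifold 𝓘(ℝ, E) 1 M := .of_le one_le_two
    have : IsManifold 𝓘(ℝ, E') 1 M' := .of_le one_le_two
    exact (contMDiffAt_iff_contMDiffAt_nhds (by simp)).1 (hΨ.of_le one_le_two)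
  have hslice : ∀ t : ℝ, ContMDiffAt 𝓘(ℝ, E) (𝓘(ℝ, ℝ).prod 𝓘(ℝ, E)) 1 (fun w : M => (t, w)) z :=
    fun t => contMDiffAt_const.prodMk contMDiffAt_id
  refine (hasDerivAt_fderiv_right (contDiffAt_chart_comp_symm hΨ)).congr_of_eventuallyEq ?_
  have hline : ContinuousAt (fun t : ℝ => (t, z)) t₀ := by fun_prop
  filter_upwards [hfix, hline.eventually hΨ1] with t ht hΨt
  have hmd : MDifferentiableAt 𝓘(ℝ, E) 𝓘(ℝ, E') (Ψ t) z :=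
    (hΨt.comp z (hslice t)).mdifferentiableAt (by simp)
  refine hmd.mfderiv.trans ?_
  simp only [mfld_simps, fderivWithin_univ, ht]
  rfl

end SmoothFamilies

/-! ### Charts -/

section Charts

theorem mdifferentiable_of_mem_maximalAtlas {𝕜 E H M : Type*} [NontriviallyNormedField 𝕜]
    [NormedAddCommGroup E] [NormedSpace 𝕜 E] [TopologicalSpace H] {I : ModelWithCorners 𝕜 E H}
    [TopologicalSpace M] [ChartedSpace H M] {n : WithTop ℕ∞} {e : OpenPartialHomeomorph M H}
    (he : e ∈ IsManifold.maximalAtlas I n M) (hn : n ≠ 0) : e.MDifferentiable I I :=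
  ⟨(contMDiffOn_of_mem_maximalAtlas he).mdifferentiableOn hn,
    (contMDiffOn_symm_of_mem_maximalAtlas he).mdifferentiableOn hn⟩

variable {m : ℕ} {P : Type u} [TopologicalSpace P] [ChartedSpace (EuclideanSpace ℝ (Fin m)) P]
  {e : OpenPartialHomeomorph P (EuclideanSpace ℝ (Fin m))} {z : P}

theorem contDiffAt_comp_symm (he : e ∈ IsManifold.maximalAtlas (𝓡 m) ∞ P) (hz : z ∈ e.source)
    (F : C^∞⟮𝓡 m, P; ℝ⟯) : ContDiffAt ℝ ∞ (F ∘ e.symm) (e z) :=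
  (F.contMDiff.contMDiffAt.comp (e z) ((contMDiffOn_symm_of_mem_maximalAtlas he).contMDiffAt
    (e.open_target.mem_nhds (e.map_source hz)))).contDiffAt

theorem differential_eq_fderiv_comp_mfderiv (he : e ∈ IsManifold.maximalAtlas (𝓡 m) ∞ P)
    (hz : z ∈ e.source) {F : C^∞⟮𝓡 m, P; ℝ⟯} {f : EuclideanSpace ℝ (Fin m) → ℝ}
    (hf : DifferentiableAt ℝ f (e z)) (hF : (F : P → ℝ) =ᶠ[𝓝 z] f ∘ e) :
    differential F z = (fderiv ℝ f (e z)).comp (mfderiv (𝓡 m) (𝓡 m) e z) := by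
  have hchart := ((mdifferentiable_of_mem_maximalAtlas he (by simp)).mdifferentiableAt
    hz).hasMFDerivAt
  exact hF.mfderiv_eq.trans (hf.hasFDerivAt.hasMFDerivAt.comp z hchart).mfderiv

theorem differential_of_eventuallyEq_clm (he : e ∈ IsManifold.maximalAtlas (𝓡 m) ∞ P)
    (hz : z ∈ e.source) (β : EuclideanSpace ℝ (Fin m) →L[ℝ] ℝ) {F : C^∞⟮𝓡 m, P; ℝ⟯}
    (hF : (F : P → ℝ) =ᶠ[𝓝 z] β ∘ e) :
    differential F z = β.comp (mfderiv (𝓡 m) (𝓡 m) e z) := by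
  rw [differential_eq_fderiv_comp_mfderiv he hz β.differentiableAt hF, β.fderiv]

theorem differential_eq_fderiv_symm (he : e ∈ IsManifold.maximalAtlas (𝓡 m) ∞ P)
    (hz : z ∈ e.source) (F : C^∞⟮𝓡 m, P; ℝ⟯) :
    differential F z = (fderiv ℝ (F ∘ e.symm) (e z)).comp (mfderiv (𝓡 m) (𝓡 m) e z) := by
  refine differential_eq_fderiv_comp_mfderiv he hz
    ((contDiffAt_comp_symm he hz F).differentiableAt (by simp)) ?_
  filter_upwards [e.open_source.mem_nhds hz] with w hw
  exact congrArg F (e.left_inv hw).symm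

theorem exists_eventuallyEq_clm [T2Space P] [IsManifold (𝓡 m) ∞ P]
    (he : e ∈ IsManifold.maximalAtlas (𝓡 m) ∞ P) (hz : z ∈ e.source)
    (β : EuclideanSpace ℝ (Fin m) →L[ℝ] ℝ) :
    ∃ F : C^∞⟮𝓡 m, P; ℝ⟯, (F : P → ℝ) =ᶠ[𝓝 z] β ∘ e :=
  exists_extension z _ (e.open_source.mem_nhds hz)
    (β.contDiff.contMDiff.comp_contMDiffOn (contMDiffOn_of_mem_maximalAtlas he))

end Charts

/-! ### Linearization of a local flow -/

section LocalFlow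

variable {m : ℕ} {P : Type u} [TopologicalSpace P] [ChartedSpace (EuclideanSpace ℝ (Fin m)) P]

theorem contMDiff_of_contMDiff_differential [T2Space P] [IsManifold (𝓡 m) ∞ P]
    {X : (w : P) → TangentSpace (𝓡 m) w}
    (hX : ∀ F : C^∞⟮𝓡 m, P; ℝ⟯, ContMDiff (𝓡 m) 𝓘(ℝ, ℝ) ∞ fun w => differential F w (X w)) :
    ContMDiff (𝓡 m) (𝓡 m).tangent ∞ fun w => (⟨w, X w⟩ : TangentBundle (𝓡 m) P) := by
  intro z
  refine (Bundle.contMDiffAt_section z).2 ?_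
  have he := IsManifold.chart_mem_maximalAtlas (I := 𝓡 m) (n := ∞) z
  have hz := mem_chart_source (EuclideanSpace ℝ (Fin m)) z
  set e := chartAt (EuclideanSpace ℝ (Fin m)) z
  choose Y hY using fun a : Fin m => exists_eventuallyEq_clm he hz (EuclideanSpace.proj a)
  have hcoord : ContMDiffAt (𝓡 m) 𝓘(ℝ, EuclideanSpace ℝ (Fin m)) ∞
      (fun w => (EuclideanSpace.equiv (Fin m) ℝ).symm fun a => differential (Y a) w (X w)) z :=
    (EuclideanSpace.equiv (Fin m) ℝ).symm.contDiff.contMDiff.contMDiffAt.comp z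
      (contMDiffAt_pi_space.2 fun a => (hX (Y a)).contMDiffAt)
  refine hcoord.congr_of_eventuallyEq ?_
  filter_upwards [e.open_source.mem_nhds hz,
    eventually_all.2 fun a => (hY a).eventually_nhds] with w hw hYw
  have htriv : (trivializationAt (EuclideanSpace ℝ (Fin m)) (TangentSpace (𝓡 m)) z ⟨w, X w⟩).2 =
      (mfderiv (𝓡 m) (𝓡 m) e w : EuclideanSpace ℝ (Fin m) →L[ℝ] EuclideanSpace ℝ (Fin m))
        (X w) := by
    have hmf := DFunLike.congr_fun
      (TangentBundle.continuousLinearMapAt_trivializationAt (I := 𝓡 m) (x₀ := z) hw) (X w)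
    rw [Bundle.Trivialization.continuousLinearMapAt_apply,
      Bundle.Trivialization.linearMapAt_apply, if_pos (by simpa using hw)] at hmf
    refine hmf.trans ?_
    simp only [mfld_simps]
    rfl
  rw [htriv]
  ext a
  exact (DFunLike.congr_fun (differential_of_eventuallyEq_clm he hw _ (hYw a)) (X w)).symm

namespace IsLocalFlow

variable {X : (w : P) → TangentSpace (𝓡 m) w} {z : P} {Φ : ℝ → P → P}

theorem contMDiffAt (hΦ : IsLocalFlow X z Φ) : ∀ᶠ t in 𝓝 (0 : ℝ),
    ContMDiffAt (𝓘(ℝ, ℝ).prod (𝓡 m)) (𝓡 m) ∞ (Function.uncurry Φ) (t, z) := by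
  obtain ⟨ε, hε, U, hU, hs, -⟩ := hΦ
  filter_upwards [Ioo_mem_nhds (neg_lt_zero.2 hε) hε] with t ht
  exact hs.contMDiffAt (prod_mem_nhds (isOpen_Ioo.mem_nhds ht) hU)

theorem apply_zero (hΦ : IsLocalFlow X z Φ) : ∀ᶠ w in 𝓝 z, Φ 0 w = w := by
  obtain ⟨ε, -, U, hU, -, h⟩ := hΦ
  filter_upwards [hU] with w hw using (h w hw).1

theorem isMIntegralCurveAt (hΦ : IsLocalFlow X z Φ) :
    ∀ᶠ w in 𝓝 z, IsMIntegralCurveAt (fun t => Φ t w) X 0 := by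
  obtain ⟨ε, hε, U, hU, -, h⟩ := hΦ
  filter_upwards [hU] with w hw
  exact (h w hw).2.isMIntegralCurveAt (Ioo_mem_nhds (neg_lt_zero.2 hε) hε)

theorem eventually_eq_self [T2Space P] [IsManifold (𝓡 m) 1 P] (hΦ : IsLocalFlow X z Φ)
    (hX : ContMDiffAt (𝓡 m) (𝓡 m).tangent 1 (fun w => (⟨w, X w⟩ : TangentBundle (𝓡 m) P)) z)
    (hz : X z = 0) : ∀ᶠ t in 𝓝 (0 : ℝ), Φ t z = z := by
  have h0 : Φ 0 z = z := hΦ.apply_zero.self_of_nhds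
  refine isMIntegralCurveAt_eventuallyEq_of_contMDiffAt_boundaryless (I := 𝓡 m) (v := X)
    (γ := fun t => Φ t z) (γ' := fun _ => z) (t₀ := 0) ?_ hΦ.isMIntegralCurveAt.self_of_nhds
    ((isMIntegralCurve_const hz).isMIntegralCurveAt 0) h0
  simpa only [h0] using hX

theorem hasDerivAt_comp (hΦ : IsLocalFlow X z Φ) (F : C^∞⟮𝓡 m, P; ℝ⟯) :
    ∀ᶠ w in 𝓝 z, HasDerivAt (fun t => F (Φ t w)) (differential F w (X w)) 0 := by
  filter_upwards [hΦ.apply_zero, hΦ.isMIntegralCurveAt] with w h0 hw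
  have hF : HasFDerivAt (fun t => F (Φ t w)) ((differential F (Φ 0 w)).comp
      (ContinuousLinearMap.smulRight (1 : ℝ →L[ℝ] ℝ) (X (Φ 0 w))) : ℝ →L[ℝ] ℝ) 0 :=
    hasMFDerivAt_iff_hasFDerivAt.1
      ((hasMFDerivAt_differential F (Φ 0 w)).comp (0 : ℝ) hw.hasMFDerivAt)
  have hval : differential F w (X w) = differential F (Φ 0 w) ((1 : ℝ) • X (Φ 0 w)) := by
    rw [one_smul, h0]
  rw [hval]
  exact hF.hasDerivAt

theorem hasDerivAt_mfderiv_comp [IsManifold (𝓡 m) ∞ P] (hΦ : IsLocalFlow X z Φ)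
    (hfix : ∀ᶠ t in 𝓝 (0 : ℝ), Φ t z = z) {F G : C^∞⟮𝓡 m, P; ℝ⟯}
    (hFG : ∀ w, differential F w (X w) = G w) :
    HasDerivAt (fun t => (mfderiv (𝓡 m) 𝓘(ℝ, ℝ) (fun w => F (Φ t w)) z :
      EuclideanSpace ℝ (Fin m) →L[ℝ] ℝ)) (differential G z) 0 := by
  have hG : (fderiv ℝ (fun y => deriv (fun t => F (Φ t
      ((chartAt (EuclideanSpace ℝ (Fin m)) z).symm y))) 0)
        (chartAt (EuclideanSpace ℝ (Fin m)) z z)) = differential G z := by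
    rw [differential, (G.contMDiff.mdifferentiableAt (by simp)).mfderiv]
    simp only [mfld_simps, fderivWithin_univ]
    refine Filter.EventuallyEq.fderiv_eq ?_
    have hsymm : Tendsto (chartAt (EuclideanSpace ℝ (Fin m)) z).symm
        (𝓝 (chartAt (EuclideanSpace ℝ (Fin m)) z z)) (𝓝 z) :=
      OpenPartialHomeomorph.tendsto_symm _ (mem_chart_source _ z)
    filter_upwards [hsymm.eventually (hΦ.hasDerivAt_comp F)] with y hy
    exact hy.deriv.trans (hFG _)
  rw [← hG]
  refine hasDerivAt_mfderiv_of_eventually_eq (Ψ := fun t w => F (Φ t w)) ?_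
    (hfix.mono fun t ht => by rw [ht, hfix.self_of_nhds])
  exact (F.contMDiff.contMDiffAt.comp (0, z) hΦ.contMDiffAt.self_of_nhds).of_le ENat.LEInfty.out

theorem differential_linearization [IsManifold (𝓡 m) ∞ P] (hΦ : IsLocalFlow X z Φ)
    (hfix : ∀ᶠ t in 𝓝 (0 : ℝ), Φ t z = z) {F G : C^∞⟮𝓡 m, P; ℝ⟯}
    (hFG : ∀ w, differential F w (X w) = G w) (v : TangentSpace (𝓡 m) z) :
    differential F z (linearization Φ z v) = differential G z v := by
  let dF : EuclideanSpace ℝ (Fin m) →L[ℝ] ℝ := differential F z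
  let L : EuclideanSpace ℝ (Fin m) →L[ℝ] EuclideanSpace ℝ (Fin m) := linearization Φ z
  let dΦ (t : ℝ) : EuclideanSpace ℝ (Fin m) →L[ℝ] EuclideanSpace ℝ (Fin m) :=
    mfderiv (𝓡 m) (𝓡 m) (Φ t) z
  have hflow : HasDerivAt dΦ L 0 :=
    (hasDerivAt_mfderiv_of_eventually_eq (hΦ.contMDiffAt.self_of_nhds.of_le ENat.LEInfty.out)
      (hfix.mono fun t ht => ht.trans hfix.self_of_nhds.symm)).differentiableAt.hasDerivAt
  have hchain : (fun t => (mfderiv (𝓡 m) 𝓘(ℝ, ℝ) (fun w => F (Φ t w)) z :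
      EuclideanSpace ℝ (Fin m) →L[ℝ] ℝ)) =ᶠ[𝓝 0] fun t => dF.comp (dΦ t) := by
    filter_upwards [hfix, hΦ.contMDiffAt] with t ht hs
    have hdΦ : MDifferentiableAt (𝓡 m) (𝓡 m) (Φ t) z :=
      (hs.comp z (contMDiffAt_const.prodMk contMDiffAt_id)).mdifferentiableAt (by simp)
    refine ((hasMFDerivAt_differential F (Φ t z)).comp z hdΦ.hasMFDerivAt).mfderiv.trans ?_
    rw [ht]
    rfl
  have hpost : HasDerivAt (fun t => dF.comp (dΦ t)) (dF.comp L) 0 := by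
    simpa using (hasDerivAt_const 0 dF).clm_comp hflow
  exact DFunLike.congr_fun ((hpost.congr_of_eventuallyEq hchain).unique
    (hΦ.hasDerivAt_mfderiv_comp hfix hFG)) v

end IsLocalFlow

theorem PoissonStructure.differential_linearization [T2Space P] [IsManifold (𝓡 m) ∞ P]
    (π : PoissonStructure m P) {H : C^∞⟮𝓡 m, P; ℝ⟯} {z : P} {Φ : ℝ → P → P}
    (hz : π.hamiltonianVectorField H z = 0) (hΦ : IsLocalFlow (π.hamiltonianVectorField H) z Φ)
    (F : C^∞⟮𝓡 m, P; ℝ⟯) (v : TangentSpace (𝓡 m) z) :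
    differential F z (linearization Φ z v) = differential (π.bracket F H) z v := by
  have hX : ContMDiff (𝓡 m) (𝓡 m).tangent ∞
      fun w => (⟨w, π.hamiltonianVectorField H w⟩ : TangentBundle (𝓡 m) P) :=
    contMDiff_of_contMDiff_differential fun F => by
      simpa only [π.differential_hamiltonianVectorField] using (π.bracket F H).contMDiff
  exact hΦ.differential_linearization
    (hΦ.eventually_eq_self (hX.contMDiffAt.of_le ENat.LEInfty.out) hz)
    (fun w => π.differential_hamiltonianVectorField F H w) v

end LocalFlow

/-! ### Darboux-Weinstein charts -/

section PartialDerivatives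

variable {m : ℕ} {f : EuclideanSpace ℝ (Fin m) → ℝ} {y : EuclideanSpace ℝ (Fin m)}

theorem fderiv_apply_eq_sum_partialDeriv (f : EuclideanSpace ℝ (Fin m) → ℝ)
    (y u : EuclideanSpace ℝ (Fin m)) : fderiv ℝ f y u = ∑ a, partialDeriv a f y * u a := by
  conv_lhs => rw [← (EuclideanSpace.basisFun (Fin m) ℝ).sum_repr u, map_sum]
  refine Finset.sum_congr rfl fun a _ => ?_
  rw [map_smul, EuclideanSpace.basisFun_apply, EuclideanSpace.basisFun_repr, smul_eq_mul, mul_comm,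
    partialDeriv]

theorem hasFDerivAt_partialDeriv (hf : ContDiffAt ℝ 2 f y) (a : Fin m) :
    HasFDerivAt (partialDeriv a f)
      ((fderiv ℝ (fderiv ℝ f) y).flip (EuclideanSpace.single a 1)) y := by
  have hf' : HasFDerivAt (fderiv ℝ f) (fderiv ℝ (fderiv ℝ f) y) y :=
    ((hf.fderiv_right (m := 1) one_add_one_eq_two.le).differentiableAt one_ne_zero).hasFDerivAt
  have hclm := hf'.clm_apply (hasFDerivAt_const (EuclideanSpace.single a (1 : ℝ)) y)
  rwa [ContinuousLinearMap.comp_zero, zero_add] at hclm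

theorem partialDeriv_comm (hf : ContDiffAt ℝ 2 f y) (a b : Fin m) :
    partialDeriv a (partialDeriv b f) y = partialDeriv b (partialDeriv a f) y := by
  have hsymm : IsSymmSndFDerivAt ℝ f y := hf.isSymmSndFDerivAt (by simp)
  rw [partialDeriv, (hasFDerivAt_partialDeriv hf b).fderiv, partialDeriv,
    (hasFDerivAt_partialDeriv hf a).fderiv]
  exact hsymm.eq _ _

end PartialDerivatives

section BracketInChart

variable {m : ℕ} {P : Type u} [TopologicalSpace P] [ChartedSpace (EuclideanSpace ℝ (Fin m)) P]
  {e : OpenPartialHomeomorph P (EuclideanSpace ℝ (Fin m))} {z : P}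

theorem differential_eq_sum_partialDeriv (he : e ∈ IsManifold.maximalAtlas (𝓡 m) ∞ P)
    (hz : z ∈ e.source) {Y : Fin m → C^∞⟮𝓡 m, P; ℝ⟯}
    (hY : ∀ a, (Y a : P → ℝ) =ᶠ[𝓝 z] fun w => e w a) (H : C^∞⟮𝓡 m, P; ℝ⟯)
    (v : TangentSpace (𝓡 m) z) :
    differential H z v = ∑ a, partialDeriv a (H ∘ e.symm) (e z) * differential (Y a) z v := by
  rw [differential_eq_fderiv_symm he hz]
  refine (fderiv_apply_eq_sum_partialDeriv _ _ _).trans (Finset.sum_congr rfl fun a _ => ?_)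
  rw [differential_of_eventuallyEq_clm he hz (EuclideanSpace.proj a) (hY a)]
  rfl

theorem PoissonStructure.bracket_antisymm (π : PoissonStructure m P) (F G : C^∞⟮𝓡 m, P; ℝ⟯) :
    π.bracket F G = -π.bracket G F :=
  (LinearMap.IsAlt.neg π.bracket_self G F).symm

theorem PoissonStructure.bracket_eq_sum_partialDeriv [T2Space P] [IsManifold (𝓡 m) ∞ P]
    (π : PoissonStructure m P) (he : e ∈ IsManifold.maximalAtlas (𝓡 m) ∞ P) (hz : z ∈ e.source)
    {Y : Fin m → C^∞⟮𝓡 m, P; ℝ⟯} (hY : ∀ a, (Y a : P → ℝ) =ᶠ[𝓝 z] fun w => e w a)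
    (F H : C^∞⟮𝓡 m, P; ℝ⟯) :
    π.bracket F H z = ∑ a, π.bracket F (Y a) z * partialDeriv a (H ∘ e.symm) (e z) := by
  have hanti : ∀ G, π.bracket F G z = -differential G z (π.hamiltonianVectorField F z) :=
    fun G => by rw [π.differential_hamiltonianVectorField, π.bracket_antisymm]; rfl
  simp only [hanti]
  rw [differential_eq_sum_partialDeriv he hz hY, ← Finset.sum_neg_distrib]
  exact Finset.sum_congr rfl fun a _ => by rw [neg_mul, mul_comm]

end BracketInChart

namespace DarbouxWeinsteinChart

variable {m : ℕ} {P : Type u} [TopologicalSpace P] [ChartedSpace (EuclideanSpace ℝ (Fin m)) P]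
  {π : PoissonStructure m P} {z₀ : P} {n r : ℕ} (c : DarbouxWeinsteinChart π z₀ n r)

/-- The projection `(𝐱, 𝐳) ↦ 𝐳` to the transverse coordinates, on which `R` depends. -/
noncomputable def transverse : EuclideanSpace ℝ (Fin m) →L[ℝ] (Fin r → ℝ) :=
  ContinuousLinearMap.pi fun k => EuclideanSpace.proj (c.index (Sum.inr k))

theorem transverse_single_inl (j : Fin n ⊕ Fin n) :
    c.transverse (EuclideanSpace.single (c.index (Sum.inl j)) 1) = 0 := by
  ext k
  simp [transverse]

theorem transverse_single_inr (l : Fin r) :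
    c.transverse (EuclideanSpace.single (c.index (Sum.inr l)) 1) = Pi.single l 1 := by
  ext k
  simp [transverse, Pi.single_apply]

theorem exists_transverse_comp_eq_id :
    ∃ s : (Fin r → ℝ) →L[ℝ] EuclideanSpace ℝ (Fin m),
      c.transverse.comp s = ContinuousLinearMap.id ℝ (Fin r → ℝ) := by
  refine ⟨∑ k, (ContinuousLinearMap.proj k).smulRight
    (EuclideanSpace.single (c.index (Sum.inr k)) 1), ?_⟩
  ext z k
  simp [transverse_single_inr, Pi.single_apply]

/-- The matrix of the Poisson tensor at the point with coordinates `y`. -/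
noncomputable def tensor (y : EuclideanSpace ℝ (Fin m)) :
    Matrix ((Fin n ⊕ Fin n) ⊕ Fin r) ((Fin n ⊕ Fin n) ⊕ Fin r) ℝ :=
  Matrix.fromBlocks (symplecticJ n) 0 0 (c.R (c.transverse y))

theorem zero_mem_target : (0 : EuclideanSpace ℝ (Fin m)) ∈ c.chart.target :=
  c.map_base ▸ c.chart.map_source c.mem_source

theorem symm_zero : c.chart.symm 0 = z₀ :=
  c.map_base ▸ c.chart.left_inv c.mem_source

theorem tendsto_symm : Tendsto c.chart.symm (𝓝 0) (𝓝 z₀) :=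
  c.map_base ▸ c.chart.tendsto_symm c.mem_source

theorem contDiffAt_localRep (H : C^∞⟮𝓡 m, P; ℝ⟯) : ContDiffAt ℝ ∞ (c.localRep H) 0 :=
  c.map_base ▸ contDiffAt_comp_symm c.mem_maximalAtlas c.mem_source H

/-- The basis `∂/∂y^b` of the tangent space at the base point, to which `coordMatrix` refers. -/
noncomputable def coordBasis :
    Module.Basis ((Fin n ⊕ Fin n) ⊕ Fin r) ℝ (TangentSpace (𝓡 m) z₀) :=
  let A : TangentSpace (𝓡 m) z₀ ≃L[ℝ] EuclideanSpace ℝ (Fin m) :=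
    (mdifferentiable_of_mem_maximalAtlas c.mem_maximalAtlas (by simp)).mfderiv c.mem_source
  ((EuclideanSpace.basisFun (Fin m) ℝ).toBasis.reindex c.index.symm).map A.symm.toLinearEquiv

theorem coordBasis_apply (b) : c.coordBasis b =
    (mfderiv (𝓡 m) (𝓡 m) c.chart.symm (c.chart z₀) :
      EuclideanSpace ℝ (Fin m) →L[ℝ] EuclideanSpace ℝ (Fin m))
        (EuclideanSpace.single (c.index b) 1) := by
  rw [coordBasis, Module.Basis.map_apply, Module.Basis.reindex_apply, Equiv.symm_symm,
    OrthonormalBasis.coe_toBasis, EuclideanSpace.basisFun_apply]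
  rfl

theorem mfderiv_coordBasis (b) : (mfderiv (𝓡 m) (𝓡 m) c.chart z₀ (c.coordBasis b) :
    EuclideanSpace ℝ (Fin m)) = EuclideanSpace.single (c.index b) 1 := by
  rw [coordBasis_apply]
  exact ((mdifferentiable_of_mem_maximalAtlas c.mem_maximalAtlas (by simp)).mfderiv
    c.mem_source).apply_symm_apply _

theorem differential_coordBasis (K : C^∞⟮𝓡 m, P; ℝ⟯) (b) :
    differential K z₀ (c.coordBasis b) = partialDeriv (c.index b) (c.localRep K) 0 := by
  rw [differential_eq_fderiv_symm c.mem_maximalAtlas c.mem_source]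
  refine (congrArg (fderiv ℝ _ _) (c.mfderiv_coordBasis b)).trans ?_
  rw [c.map_base]
  rfl

theorem coordMatrix_eq_toMatrix (L : TangentSpace (𝓡 m) z₀ →L[ℝ] TangentSpace (𝓡 m) z₀) :
    c.coordMatrix L = LinearMap.toMatrix c.coordBasis c.coordBasis L.toLinearMap := by
  ext a b
  rw [LinearMap.toMatrix_apply, coordBasis_apply]
  rfl

section coordFunction

variable [T2Space P] [IsManifold (𝓡 m) ∞ P]

/-- A global smooth function that agrees with the coordinate `y^a` near the base point: the Poisson
bracket is defined for global functions only. -/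
noncomputable def coordFunction (a : (Fin n ⊕ Fin n) ⊕ Fin r) : C^∞⟮𝓡 m, P; ℝ⟯ :=
  (exists_eventuallyEq_clm c.mem_maximalAtlas c.mem_source
    (EuclideanSpace.proj (c.index a))).choose

theorem coordFunction_eventuallyEq (a) :
    (c.coordFunction a : P → ℝ) =ᶠ[𝓝 z₀] fun w => c.chart w (c.index a) :=
  (exists_eventuallyEq_clm c.mem_maximalAtlas c.mem_source
    (EuclideanSpace.proj (c.index a))).choose_spec

theorem coordMatrix_apply (L : TangentSpace (𝓡 m) z₀ →L[ℝ] TangentSpace (𝓡 m) z₀) (a b) :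
    c.coordMatrix L a b = differential (c.coordFunction a) z₀ (L (c.coordBasis b)) := by
  rw [differential_of_eventuallyEq_clm c.mem_maximalAtlas c.mem_source
    (EuclideanSpace.proj (c.index a)) (c.coordFunction_eventuallyEq a), coordBasis_apply]
  rfl

theorem eventually_bracket_coordFunction : ∀ᶠ w in 𝓝 z₀, ∀ a b,
    π.bracket (c.coordFunction a) (c.coordFunction b) w = c.tensor (c.chart w) a b := by
  filter_upwards [c.chart.open_source.mem_nhds c.mem_source,
    eventually_all.2 fun a => (c.coordFunction_eventuallyEq a).eventually_nhds] with w hw hY a b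
  exact c.bracket_coord w hw a b _ _ (hY a) (hY b)

theorem eventually_bracket_eq_sum (F H : C^∞⟮𝓡 m, P; ℝ⟯) : ∀ᶠ w in 𝓝 z₀, π.bracket F H w =
    ∑ b, π.bracket F (c.coordFunction b) w *
      partialDeriv (c.index b) (c.localRep H) (c.chart w) := by
  filter_upwards [c.chart.open_source.mem_nhds c.mem_source,
    eventually_all.2 fun a => (c.coordFunction_eventuallyEq a).eventually_nhds] with w hw hY
  have hY' : ∀ i, (c.coordFunction (c.index.symm i) : P → ℝ) =ᶠ[𝓝 w] fun w' => c.chart w' i :=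
    c.index.forall_congr_right.1 fun a => by rw [Equiv.symm_apply_apply]; exact hY a
  rw [π.bracket_eq_sum_partialDeriv c.mem_maximalAtlas hw hY', ← c.index.sum_comp]
  simp only [Equiv.symm_apply_apply]
  rfl

theorem localRep_bracket_eventuallyEq (H : C^∞⟮𝓡 m, P; ℝ⟯) (a) :
    c.localRep (π.bracket (c.coordFunction a) H) =ᶠ[𝓝 0] fun y =>
      ∑ b, c.tensor y a b * partialDeriv (c.index b) (c.localRep H) y := by
  filter_upwards [c.tendsto_symm.eventually c.eventually_bracket_coordFunction,
    c.tendsto_symm.eventually (c.eventually_bracket_eq_sum (c.coordFunction a) H),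
    c.chart.open_target.mem_nhds c.zero_mem_target] with y htensor hsum hy
  rw [localRep, hsum]
  simp only [htensor, c.chart.right_inv hy]

theorem localRep_bracket_inl_eventuallyEq (H : C^∞⟮𝓡 m, P; ℝ⟯) (i : Fin n ⊕ Fin n) :
    c.localRep (π.bracket (c.coordFunction (Sum.inl i)) H) =ᶠ[𝓝 0] fun y =>
      ∑ p, symplecticJ n i p * partialDeriv (c.index (Sum.inl p)) (c.localRep H) y := by
  filter_upwards [c.localRep_bracket_eventuallyEq H (Sum.inl i)] with y hy
  simpa [tensor] using hy

theorem localRep_bracket_inr_eventuallyEq (H : C^∞⟮𝓡 m, P; ℝ⟯) (k : Fin r) :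
    c.localRep (π.bracket (c.coordFunction (Sum.inr k)) H) =ᶠ[𝓝 0] fun y =>
      ∑ p, c.R (c.transverse y) k p * partialDeriv (c.index (Sum.inr p)) (c.localRep H) y := by
  filter_upwards [c.localRep_bracket_eventuallyEq H (Sum.inr k)] with y hy
  simpa [tensor] using hy

theorem differentiableAt_R (k p : Fin r) : DifferentiableAt ℝ (fun z => c.R z k p) 0 := by
  obtain ⟨s, hs⟩ := c.exists_transverse_comp_eq_id
  have hs0 : Tendsto s (𝓝 0) (𝓝 0) := s.continuous.tendsto' 0 0 s.map_zero
  have hR : (fun z => c.R z k p) =ᶠ[𝓝 0] fun z => c.localRep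
      (π.bracket (c.coordFunction (Sum.inr k)) (c.coordFunction (Sum.inr p))) (s z) := by
    filter_upwards [hs0.eventually
      (c.tendsto_symm.eventually c.eventually_bracket_coordFunction),
      hs0.eventually (c.chart.open_target.mem_nhds c.zero_mem_target)] with z hz hzt
    rw [localRep, hz, c.chart.right_inv hzt, tensor, Matrix.fromBlocks_apply₂₂]
    exact congrArg (c.R · k p) (DFunLike.congr_fun hs z).symm
  have hloc : DifferentiableAt ℝ (c.localRep
      (π.bracket (c.coordFunction (Sum.inr k)) (c.coordFunction (Sum.inr p)))) (s 0) := by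
    rw [s.map_zero]
    exact (c.contDiffAt_localRep _).differentiableAt (by simp)
  exact (hloc.comp (0 : Fin r → ℝ) s.differentiableAt).congr_of_eventuallyEq hR

theorem partialDeriv_localRep_bracket_inl (H : C^∞⟮𝓡 m, P; ℝ⟯) (i : Fin n ⊕ Fin n) (a : Fin m) :
    partialDeriv a (c.localRep (π.bracket (c.coordFunction (Sum.inl i)) H)) 0 =
      ∑ p, symplecticJ n i p *
        partialDeriv (c.index (Sum.inl p)) (partialDeriv a (c.localRep H)) 0 := by
  have hH : ContDiffAt ℝ 2 (c.localRep H) 0 := (c.contDiffAt_localRep H).of_le ENat.LEInfty.out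
  have hsum := HasFDerivAt.fun_sum (u := Finset.univ) fun (p : Fin n ⊕ Fin n) _ =>
    (hasFDerivAt_partialDeriv hH (c.index (Sum.inl p))).differentiableAt.hasFDerivAt.const_mul
      (symplecticJ n i p)
  rw [partialDeriv, (c.localRep_bracket_inl_eventuallyEq H i).fderiv_eq, hsum.fderiv, sum_apply]
  refine Finset.sum_congr rfl fun p _ => ?_
  rw [partialDeriv_comm hH]
  rfl

theorem partialDeriv_localRep_bracket_inr (H : C^∞⟮𝓡 m, P; ℝ⟯) (k : Fin r) (a : Fin m) :
    partialDeriv a (c.localRep (π.bracket (c.coordFunction (Sum.inr k)) H)) 0 =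
      ∑ p, fderiv ℝ (fun z => c.R z k p) 0 (c.transverse (EuclideanSpace.single a 1)) *
        partialDeriv (c.index (Sum.inr p)) (c.localRep H) 0 := by
  have hH : ContDiffAt ℝ 2 (c.localRep H) 0 := (c.contDiffAt_localRep H).of_le ENat.LEInfty.out
  have hR : ∀ p, HasFDerivAt (fun y => c.R (c.transverse y) k p)
      ((fderiv ℝ (fun z => c.R z k p) 0).comp c.transverse) 0 := fun p =>
    HasFDerivAt.comp (g := fun z => c.R z k p) 0
      (by rw [map_zero]; exact (c.differentiableAt_R k p).hasFDerivAt) c.transverse.hasFDerivAt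
  have hsum := HasFDerivAt.fun_sum (u := Finset.univ) fun (p : Fin r) _ =>
    (hR p).fun_mul (hasFDerivAt_partialDeriv hH (c.index (Sum.inr p)))
  rw [partialDeriv, (c.localRep_bracket_inr_eventuallyEq H k).fderiv_eq, hsum.fderiv, sum_apply]
  refine Finset.sum_congr rfl fun p _ => ?_
  simp [c.R_zero, mul_comm]

theorem differential_coordFunction_inr_eq_zero {v : TangentSpace (𝓡 m) z₀}
    (hv : v ∈ π.characteristicSpace z₀) (k : Fin r) :
    differential (c.coordFunction (Sum.inr k)) z₀ v = 0 := by
  obtain ⟨G, rfl⟩ := hv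
  have hzero := (c.localRep_bracket_inr_eventuallyEq G k).self_of_nhds
  simp only [localRep, c.symm_zero, map_zero, c.R_zero, Matrix.zero_apply, zero_mul,
    Finset.sum_const_zero] at hzero
  exact (π.differential_hamiltonianVectorField _ _ _).trans hzero

variable {H : C^∞⟮𝓡 m, P; ℝ⟯} {L : TangentSpace (𝓡 m) z₀ →L[ℝ] TangentSpace (𝓡 m) z₀}

theorem coordMatrix_eq_fromBlocks
    (hL : ∀ F v, differential F z₀ (L v) = differential (π.bracket F H) z₀ v) :
    c.coordMatrix L = Matrix.fromBlocks (c.blockS H) (c.blockQ H) 0 (c.blockP H) := by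
  ext (i | k) b
  · rw [coordMatrix_apply, hL, differential_coordBasis, partialDeriv_localRep_bracket_inl]
    cases b <;> rfl
  · rw [coordMatrix_apply, hL, differential_coordBasis, partialDeriv_localRep_bracket_inr]
    rcases b with j | l
    · simp [transverse_single_inl]
    · rw [transverse_single_inr]
      rfl

theorem blockP_eq_zero
    (hL : ∀ F v, differential F z₀ (L v) = differential (π.bracket F H) z₀ v)
    (hrange : LinearMap.range L.toLinearMap ≤ π.characteristicSpace z₀) : c.blockP H = 0 := by
  ext k l
  have hentry := congrFun₂ (c.coordMatrix_eq_fromBlocks hL) (Sum.inr k) (Sum.inr l)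
  rw [coordMatrix_apply] at hentry
  have hmem := hrange (LinearMap.mem_range_self L.toLinearMap (c.coordBasis (Sum.inr l)))
  exact hentry.symm.trans (c.differential_coordFunction_inr_eq_zero hmem k)

end coordFunction

end DarbouxWeinsteinChart

end PoissonLin

theorem corollary2p4_general {m : ℕ}
    {P : Type u} [TopologicalSpace P] [T2Space P] [ChartedSpace (EuclideanSpace ℝ (Fin m)) P]
    [IsManifold (𝓡 m) ∞ P]
    (π : PoissonLin.PoissonStructure m P) (H : C^∞⟮𝓡 m, P; ℝ⟯) {z : P}
    (hreg : π.IsRegularPoint z) (heq : π.hamiltonianVectorField H z = 0)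
    (Φ : ℝ → P → P) (hΦ : PoissonLin.IsLocalFlow (π.hamiltonianVectorField H) z Φ)
    (L : TangentSpace (𝓡 m) z →L[ℝ] TangentSpace (𝓡 m) z)
    (hL : L = PoissonLin.linearization Φ z) :
    (∀ (n r : ℕ) (c : PoissonLin.DarbouxWeinsteinChart π z n r),
      c.coordMatrix L = Matrix.fromBlocks (c.blockS H) (c.blockQ H) 0 (c.blockP H) ∧
      c.blockP H = 0) ∧
    (∀ (lam : ℝ) (w : TangentSpace (𝓡 m) z), lam ≠ 0 → L w = lam • w →
      w ∈ π.characteristicSpace z) ∧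
    (∀ (lam : ℂ) (w : ℂ ⊗[ℝ] TangentSpace (𝓡 m) z), lam ≠ 0 →
      L.toLinearMap.baseChange ℂ w = lam • w →
      w ∈ (π.characteristicSpace z).baseChange ℂ) ∧
    (PoissonLin.unstableSpace L.toLinearMap ⊆
      (π.characteristicSpace z : Set (TangentSpace (𝓡 m) z))) ∧
    (∀ (n r : ℕ) (c : PoissonLin.DarbouxWeinsteinChart π z n r),
      PoissonLin.complexEigenvalues (c.coordMatrix L) =
        PoissonLin.complexEigenvalues (c.blockS H) + Multiset.replicate r 0 ∧
      ∀ lam : ℂ, Module.End.HasEigenvalue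
          (L.toLinearMap.baseChange ℂ : Module.End ℂ (ℂ ⊗[ℝ] TangentSpace (𝓡 m) z)) lam ↔
        lam ∈ PoissonLin.complexEigenvalues (c.blockS H) ∨ (lam = 0 ∧ 0 < r)) := by
  subst hL
  have hd := π.differential_linearization heq hΦ
  have hrange := π.range_le_characteristicSpace hreg heq hd
  have hblock := fun (n r : ℕ) (c : PoissonLin.DarbouxWeinsteinChart π z n r) =>
    And.intro (c.coordMatrix_eq_fromBlocks hd) (c.blockP_eq_zero hd hrange)
  refine ⟨hblock, fun lam w hlam hw => ?_, fun lam w hlam hw => ?_,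
    PoissonLin.unstableSpace_subset hrange, fun n r c => ?_⟩
  · exact (Submodule.smul_mem_iff _ hlam).1 (hw ▸ hrange (LinearMap.mem_range_self _ w))
  · exact (Submodule.smul_mem_iff _ hlam).1
      (hw ▸ PoissonLin.range_baseChange_le ℂ hrange (LinearMap.mem_range_self _ w))
  · have hspec : PoissonLin.complexEigenvalues (c.coordMatrix (PoissonLin.linearization Φ z)) =
        PoissonLin.complexEigenvalues (c.blockS H) + Multiset.replicate r 0 := by
      rw [(hblock n r c).1, (hblock n r c).2, PoissonLin.complexEigenvalues_fromBlocks_zero,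
        Fintype.card_fin]
    refine ⟨hspec, fun lam => ?_⟩
    rw [PoissonLin.hasEigenvalue_baseChange_iff c.coordBasis, ← c.coordMatrix_eq_toMatrix, hspec,
      Multiset.mem_add, Multiset.mem_replicate, and_comm, Nat.pos_iff_ne_zero]

theorem corollary2p4 {m k : ℕ}
    {P : Type u} [TopologicalSpace P] [T2Space P] [ChartedSpace (EuclideanSpace ℝ (Fin m)) P]
    [IsManifold (𝓡 m) ∞ P]
    (π : PoissonLin.PoissonStructure m P) (H : C^∞⟮𝓡 m, P; ℝ⟯)
    {N : Type v} [TopologicalSpace N] [ChartedSpace (EuclideanSpace ℝ (Fin k)) N]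
    [IsManifold (𝓡 k) ∞ N]
    (ι : N → P) (hleaf : π.IsSymplecticLeaf k ι) (hreg : π.IsRegularLeaf ι)
    (x : N) (heq : π.hamiltonianVectorField H (ι x) = 0)
    (Φ : ℝ → P → P) (hΦ : PoissonLin.IsLocalFlow (π.hamiltonianVectorField H) (ι x) Φ)
    (L : TangentSpace (𝓡 m) (ι x) →L[ℝ] TangentSpace (𝓡 m) (ι x))
    (hL : L = PoissonLin.linearization Φ (ι x)) :
    -- the block form of the linearization, and the vanishing of its transverse block
    (∀ (n r : ℕ) (c : PoissonLin.DarbouxWeinsteinChart π (ι x) n r),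
      c.coordMatrix L = Matrix.fromBlocks (c.blockS H) (c.blockQ H) 0 (c.blockP H) ∧
      c.blockP H = 0) ∧
    -- real eigenvectors, complex eigenvectors, and unstable directions are tangent to the leaf
    (∀ (lam : ℝ) (w : TangentSpace (𝓡 m) (ι x)), lam ≠ 0 → L w = lam • w →
      w ∈ PoissonLin.immersedTangentSpace m k ι x) ∧
    (∀ (lam : ℂ) (w : ℂ ⊗[ℝ] TangentSpace (𝓡 m) (ι x)), lam ≠ 0 →
      L.toLinearMap.baseChange ℂ w = lam • w →
      w ∈ (PoissonLin.immersedTangentSpace m k ι x).baseChange ℂ) ∧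
    (PoissonLin.unstableSpace L.toLinearMap ⊆
      (PoissonLin.immersedTangentSpace m k ι x : Set (TangentSpace (𝓡 m) (ι x)))) ∧
    -- the eigenvalues besides those of the symplectic block
    (∀ (n r : ℕ) (c : PoissonLin.DarbouxWeinsteinChart π (ι x) n r)
      (v : Module.Basis (Fin r) ℂ (Fin r → ℂ)) (μ : Fin r → ℂ),
      (∀ j, (c.blockP H).map (algebraMap ℝ ℂ) *ᵥ v j = μ j • v j) →
      (∀ j, ∃ w, (c.blockS H).map (algebraMap ℝ ℂ) *ᵥ w =
        (c.blockQ H).map (algebraMap ℝ ℂ) *ᵥ v j) →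
      PoissonLin.complexEigenvalues (c.coordMatrix L) =
        PoissonLin.complexEigenvalues (c.blockS H) + Multiset.replicate r 0 ∧
      ∀ lam : ℂ, Module.End.HasEigenvalue
          (L.toLinearMap.baseChange ℂ : Module.End ℂ (ℂ ⊗[ℝ] TangentSpace (𝓡 m) (ι x))) lam ↔
        lam ∈ PoissonLin.complexEigenvalues (c.blockS H) ∨ (lam = 0 ∧ 0 < r)) := by
  obtain ⟨hblock, hreal, hcomplex, hunstable, hspec⟩ :=
    corollary2p4_general π H (hreg x) heq Φ hΦ L hL
  rw [hleaf.tangent_eq x]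
  exact ⟨hblock, hreal, hcomplex, hunstable, fun n r c _ _ _ _ => hspec n r c⟩
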